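/- **Setting.** For a finite index set $I$ and a partial Boolean function $f : D \to \{0,1\}$, $D \subseteq \{0,1\}^I$, let $\mathsf{Q}(f)$ be its bounded-error quantum query complexity: the least $T$ such that some quantum algorithm, making $T$ queries to the oracle $|i\rangle|b\rangle \mapsto |i\rangle|b \oplus x_i\rangle$ interleaved with arbitrary input-independent unitaries (on a finite workspace of any size; idle queries are allowed), outputs $f(x)$ with probability at least $2/3$ for every $x \in D$. Inputs are simple graphs on the vertex set $[n] = \{1,\dots,n\}$, given by their adjacency matrices: undirected graphs are elements of $\{0,1\}^{\binom{[n]}{2}}$, and directed graphs are elements of $\{0,1\}^{\{(v,w) \in [n]^2 : v \neq w\}}$ (both arcs between two vertices may be present). Put $s = 1$ and $t = 2$. A (directed) path of length $\ell \ge 1$ is a sequence of $\ell+1$ distinct vertices $v_0,\dots,v_\ell$ such that $\{v_{i-1},v_i\}$ is an edge (respectively $(v_{i-1},v_i)$ is an arc) for all $1 \le i \le \ell$; it is a path from $s$ to $t$ if $v_0 = s$ and $v_\ell = t$. For $k \ge 1$ consider the following decision problems, each being a sequence of (partial) Boolean functions indexed by $n$. * $\mathtt{Path}_{s,t}^{=k}$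 and $\mathtt{Path}_{s,t}^{\le k}$: does the undirected input graph contain a path from $s$ to $t$ of length exactly $k$, respectively of some length $\ell \in \{1,\dots,k\}$? * $\mathtt{DirPath}_{s,t}^{=k}$ and $\mathtt{DirPath}_{s,t}^{\le k}$: the same questions for directed paths from $s$ to $t$ in a directed input graph. * $\mathtt{PromDirPath}_{s,t}^{=k}$ and $\mathtt{PromDirPath}_{s,t}^{\le k}$: the problems $\mathtt{DirPath}_{s,t}^{=k}$ and $\mathtt{DirPath}_{s,t}^{\le k}$, restricted to the inputs for which, if there is any directed path from $s$ to $t$, then there is one of length exactly $k$, respectively at most $k$. * $\mathtt{DirPath}^{=k}$: does the directed input graph contain a directed path of length exactly $k$ (between any two vertices)? **Statement.** Let $k \ge 3$ be a fixed integer. Then the seven problems $$\mathtt{DirPath}_{s,t}^{=k},\quad \mathtt{DirPath}_{s,t}^{\le k},\quad \mathtt{PromDirPath}_{s,t}^{=k},\quad \mathtt{PromDirPath}_{s,t}^{\le k},\quad \mathtt{Path}_{s,t}^{=k},\quad \mathtt{Path}_{s,t}^{\le k},\quad \mathtt{DirPath}^{=k-2}$$ all have the same quantum query complexity up to constants: for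 any two of them, $\mathtt{P}$ and $\mathtt{P}'$, we have $\mathsf{Q}(\mathtt{P}) \in \Theta(\mathsf{Q}(\mathtt{P}'))$ as functions of the number $n$ of vertices, as $n \to \infty$ (the implied constants and the threshold for $n$ may depend on $k$). -/

import Mathlib

open Filter Asymptotics

/-! ## Bounded-error quantum query complexity of partial Boolean functions -/

/-- A partial Boolean function on inputs `x : ι → Bool`, i.e. on `{0,1}^ι`. Its domain is `promise`,
and on the domain it takes the value `1` exactly on the members of `yes`. -/
structure QueryProblem (ι : Type) where
  promise : Set (ι → Bool)
  yes : Set (ι → Bool)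

/-- A quantum query algorithm for inputs in `{0,1}^ι`. Its state space has as orthonormal basis the
states `|i⟩|b⟩|w⟩` with `i : Option ι` (query register, where `none` is the idle query), `b : Bool`
(answer register) and `w : W` (finite, arbitrarily large workspace). It starts in the basis state
`init`, applies the unitary `U 0`, then alternates input queries with `U 1`, `U 2`, …, and in the
end measures in the standard basis and outputs the bit `out`. -/
structure QueryAlgorithm (ι : Type) [Fintype ι] [DecidableEq ι] where
  W : Type
  [fintypeW : Fintype W]
  [decEqW : DecidableEq W]
  init : Option ι × Bool × W
  U : ℕ → Matrix.unitaryGroup (Option ι × Bool × W) ℂ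
  out : Option ι × Bool × W → Bool

attribute [instance] QueryAlgorithm.fintypeW QueryAlgorithm.decEqW

namespace QueryAlgorithm

variable {ι : Type} [Fintype ι] [DecidableEq ι]

/-- The input oracle `|i⟩|b⟩|w⟩ ↦ |i⟩|b ⊕ xᵢ⟩|w⟩`, where the idle query acts as the identity
(this map is an involution on basis states, so that it reads the same on amplitudes). -/
def oracle {W : Type} (x : ι → Bool) (ψ : Option ι × Bool × W → ℂ) : Option ι × Bool × W → ℂ :=
  fun p => ψ (p.1, xor p.2.1 (p.1.elim false x), p.2.2)

/-- The state `U_t O_x U_{t-1} O_x ⋯ O_x U_0 |init⟩`, after `t` queries to the input `x`. -/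
noncomputable def state (A : QueryAlgorithm ι) (x : ι → Bool) : ℕ → (Option ι × Bool × A.W → ℂ)
  | 0 => (A.U 0).1.mulVec (Pi.single A.init 1)
  | t + 1 => (A.U (t + 1)).1.mulVec (oracle x (A.state x t))

/-- The probability that the algorithm, run with `T` queries on the input `x`, outputs `c`. -/
noncomputable def outputProb (A : QueryAlgorithm ι) (T : ℕ) (x : ι → Bool) (c : Bool) : ℝ :=
  ∑ p, if A.out p = c then ‖A.state x T p‖ ^ 2 else 0

/-- With `T` queries, the algorithm outputs the correct value with probability at least `2/3` on
every input in the domain of the problem. -/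
def Solves (A : QueryAlgorithm ι) (T : ℕ) (P : QueryProblem ι) : Prop :=
  ∀ x ∈ P.promise, (x ∈ P.yes → 2 / 3 ≤ A.outputProb T x true) ∧
    (x ∉ P.yes → 2 / 3 ≤ A.outputProb T x false)

theorem le_outputProb (A : QueryAlgorithm ι) (T : ℕ) (x : ι → Bool) {c : Bool}
    {p : Option ι × Bool × A.W} (h : A.out p = c) :
    ‖A.state x T p‖ ^ 2 ≤ A.outputProb T x c := by
  refine le_trans (le_of_eq ?_) (Finset.single_le_sum
    (f := fun p => if A.out p = c then ‖A.state x T p‖ ^ 2 else 0)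
    (fun p _ => by positivity) (Finset.mem_univ p))
  rw [if_pos h]

end QueryAlgorithm

/-- The quantum query complexity: the least number of queries with which some quantum query
algorithm solves the problem (the minimum is over a nonempty set, see
`exists_queryAlgorithm_solves`). -/
noncomputable def quantumQueryComplexity {ι : Type} [Fintype ι] [DecidableEq ι]
    (P : QueryProblem ι) : ℕ :=
  sInf {T : ℕ | ∃ A : QueryAlgorithm ι, A.Solves T P}

/-! ### Every problem is solved by reading the whole input -/

namespace ReadAll

variable {ι : Type} [Fintype ι] [DecidableEq ι]

/-- The basis state `|some j⟩|b⟩|m⟩` gets its answer bit exchanged with the memory cell `j`. -/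
def store : Option ι × Bool × (ι → Bool) → Option ι × Bool × (ι → Bool)
  | (none, b, m) => (none, b, m)
  | (some j, b, m) => (some j, m j, Function.update m j b)

theorem store_involutive {ι : Type} [DecidableEq ι] : Function.Involutive (store (ι := ι)) := by
  rintro ⟨_ | j, b, m⟩ <;> simp [store]

/-- The index that is read by the query number `t`. -/
noncomputable def idx (ι : Type) [Fintype ι] (t : ℕ) : Option ι :=
  if h : t < Fintype.card ι then some ((Fintype.equivFin ι).symm ⟨t, h⟩) else none

/-- Exchange the values `a` and `b` of the query register. -/
def move (a b : Option ι) : Equiv.Perm (Option ι × Bool × (ι → Bool)) :=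
  (Equiv.swap a b).prodCongr (Equiv.refl _)

noncomputable def perm : ℕ → Equiv.Perm (Option ι × Bool × (ι → Bool))
  | 0 => move none (idx ι 0)
  | t + 1 => store_involutive.toPerm.trans (move (idx ι t) (idx ι (t + 1)))

/-- The unitary that permutes basis states. -/
def permUnitary {B : Type} [Fintype B] [DecidableEq B] (σ : Equiv.Perm B) :
    Matrix.unitaryGroup B ℂ :=
  ⟨Equiv.Perm.permMatrix ℂ σ⁻¹, by
    rw [Matrix.mem_unitaryGroup_iff]
    rw [Matrix.star_eq_conjTranspose, Matrix.conjTranspose_permMatrix, ← Matrix.permMatrix_mul]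
    simp⟩

theorem permUnitary_mulVec {B : Type} [Fintype B] [DecidableEq B] (σ : Equiv.Perm B) (p : B) :
    (permUnitary σ).1.mulVec (Pi.single p 1) = Pi.single (σ p) 1 := by
  ext q
  simp only [permUnitary, Matrix.permMatrix_mulVec, Function.comp, Pi.single_apply]
  have h : σ⁻¹ q = p ↔ q = σ p := Equiv.Perm.inv_eq_iff_eq
  by_cases hq : q = σ p
  · simp [hq]
  · simp only [hq, if_false]
    exact if_neg (fun e => hq (h.1 e))

open Classical in
/-- The algorithm that reads the whole input into its memory and then outputs the answer. -/
noncomputable def algorithm (P : QueryProblem ι) : QueryAlgorithm ι where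
  W := ι → Bool
  init := (none, false, fun _ => false)
  U t := permUnitary (perm t)
  out p := decide (p.2.2 ∈ P.yes)

/-- The content of the memory after `t` queries. -/
noncomputable def mem (x : ι → Bool) (t : ℕ) : ι → Bool :=
  fun j => if (Fintype.equivFin ι j : ℕ) < t then x j else false

theorem oracle_single {ι W : Type} [DecidableEq ι] [DecidableEq W] (x : ι → Bool) (i : Option ι) (b : Bool) (w : W) :
    QueryAlgorithm.oracle x (Pi.single (i, b, w) 1) =
      Pi.single (i, xor b (i.elim false x), w) 1 := by
  ext ⟨i', b', w'⟩
  simp only [QueryAlgorithm.oracle, Pi.single_apply, Prod.mk.injEq]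
  by_cases h : i' = i
  · subst h
    cases b <;> cases b' <;> cases (i'.elim false x) <;> simp
  · simp [h]

theorem state_eq (P : QueryProblem ι) (x : ι → Bool) (t : ℕ) :
    (algorithm P).state x t = Pi.single (idx ι t, false, mem x t) 1 := by
  induction t with
  | zero =>
    refine (permUnitary_mulVec _ _).trans ?_
    have h : perm 0 (none, false, fun _ => false) = (idx ι 0, false, mem x 0) := by
      have hm : mem x 0 = fun _ => false := funext fun j => by simp [mem]
      rw [hm]
      simp [perm, move]
    exact congrArg (fun p => Pi.single p (1 : ℂ)) h
  | succ t ih =>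
    rw [QueryAlgorithm.state, ih]
    refine (congrArg _ (oracle_single x (idx ι t) false (mem x t))).trans ?_
    refine (permUnitary_mulVec _ _).trans ?_
    congr 1
    have hs : store (idx ι t, xor false ((idx ι t).elim false x), mem x t) =
        (idx ι t, false, mem x (t + 1)) := by
      by_cases h : t < Fintype.card ι
      · have hi : idx ι t = some ((Fintype.equivFin ι).symm ⟨t, h⟩) := by simp [idx, h]
        rw [hi]
        refine Prod.ext rfl (Prod.ext ?_ (funext fun j => ?_))
        · simp [store, mem]
        · by_cases hj : j = (Fintype.equivFin ι).symm ⟨t, h⟩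
          · subst hj
            simp [store, mem]
          · have hne : (Fintype.equivFin ι j : ℕ) ≠ t := fun e => hj (by
              rw [Equiv.eq_symm_apply]
              exact Fin.ext e)
            have : (Fintype.equivFin ι j : ℕ) < t + 1 ↔ (Fintype.equivFin ι j : ℕ) < t := by omega
            simp [store, mem, Function.update_of_ne hj, this]
      · have hi : idx ι t = none := by simp [idx, h]
        rw [hi]
        refine Prod.ext rfl (Prod.ext rfl (funext fun j => ?_))
        have hj := (Fintype.equivFin ι j).isLt
        have h1 : (Fintype.equivFin ι j : ℕ) < t := by omega
        have h2 : (Fintype.equivFin ι j : ℕ) < t + 1 := by omega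
        simp [store, mem, h1, h2]
    change move _ _ (store _) = _
    rw [hs]
    simp [move]

end ReadAll

theorem exists_queryAlgorithm_solves {ι : Type} [Fintype ι] [DecidableEq ι] (P : QueryProblem ι) :
    ∃ (T : ℕ) (A : QueryAlgorithm ι), A.Solves T P := by
  classical
  refine ⟨Fintype.card ι, ReadAll.algorithm P, fun x _ => ?_⟩
  have hm : ReadAll.mem x (Fintype.card ι) = x := funext fun j => by simp [ReadAll.mem]
  have key : ∀ c, decide (x ∈ P.yes) = c →
      (2 / 3 : ℝ) ≤ (ReadAll.algorithm P).outputProb (Fintype.card ι) x c := by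
    intro c hc
    have ho : (ReadAll.algorithm P).out (ReadAll.idx ι (Fintype.card ι), false, x) = c := by
      rw [← hc]
      simp [ReadAll.algorithm]
    refine le_trans ?_ (QueryAlgorithm.le_outputProb _ _ x ho)
    have hs : (ReadAll.algorithm P).state x (Fintype.card ι)
        (ReadAll.idx ι (Fintype.card ι), false, x) = 1 := by
      rw [ReadAll.state_eq, hm]
      exact Pi.single_eq_same _ _
    rw [hs]
    norm_num
  exact ⟨fun h => key true (by simp [h]), fun h => key false (by simp [h])⟩

/-! ## Subgraph-containment problems in the adjacency-matrix model -/

/-- The index set `binom(V, 2)` of the adjacency matrices of undirected graphs. -/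
abbrev EdgeIndex (V : Type) : Type := {e : Sym2 V // ¬ e.IsDiag}

/-- The index set `{(v, w) : v ≠ w}` of the adjacency matrices of directed graphs. -/
abbrev ArcIndex (V : Type) : Type := {a : V × V // a.1 ≠ a.2}

/-- The undirected graph with the given adjacency matrix. -/
def graphOf {V : Type} (x : EdgeIndex V → Bool) : SimpleGraph V where
  Adj v w := ∃ h : ¬ (s(v, w) : Sym2 V).IsDiag, x ⟨s(v, w), h⟩ = true
  symm := ⟨fun v w ⟨h, hx⟩ => by
    have e : (s(v, w) : Sym2 V) = s(w, v) := Sym2.eq_swap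
    exact ⟨e ▸ h, by simpa only [e] using hx⟩⟩
  loopless := ⟨fun v ⟨h, _⟩ => h (by simp)⟩

/-- The directed graph with the given adjacency matrix. -/
def digraphOf {V : Type} (x : ArcIndex V → Bool) : Digraph V where
  Adj v w := ∃ h : v ≠ w, x ⟨(v, w), h⟩ = true

/-- For an undirected graph `H` with distinguished vertices `v 0, …, v (m-1)`: does the input graph
on the vertex set `{0, …, n-1}` contain a copy of `H` in which `v j` is placed at the vertex `j`,
for all `j < m`? -/
def subgraphProblem {VH : Type} (H : SimpleGraph VH) {m : ℕ} (v : Fin m → VH) (n : ℕ) :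
    QueryProblem (EdgeIndex (Fin n)) where
  promise := Set.univ
  yes := {x | ∃ φ : VH ↪ Fin n, (∀ j, (φ (v j) : ℕ) = j) ∧
    ∀ a b, H.Adj a b → (graphOf x).Adj (φ a) (φ b)}

/-- The same problem for directed graphs. -/
def dirSubgraphProblem {VH : Type} (H : Digraph VH) {m : ℕ} (v : Fin m → VH) (n : ℕ) :
    QueryProblem (ArcIndex (Fin n)) where
  promise := Set.univ
  yes := {x | ∃ φ : VH ↪ Fin n, (∀ j, (φ (v j) : ℕ) = j) ∧
    ∀ a b, H.Adj a b → (digraphOf x).Adj (φ a) (φ b)}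

/-! ## Path-containment problems

The undirected line graph with `k` edges is `SimpleGraph.pathGraph (k + 1)`. In the restricted
problems, its end vertices `0` and `k` have to be placed at `s = 0` and `t = 1`. -/

/-- The line graph with `k` edges, all of them pointing from the vertex `0` to the vertex `k`. -/
def dirLine (k : ℕ) : Digraph (Fin (k + 1)) where
  Adj i j := (i : ℕ) + 1 = j

/-- Is there a path of length exactly `k` between `s` and `t`? -/
def pathEqST (k n : ℕ) : QueryProblem (EdgeIndex (Fin n)) :=
  subgraphProblem (SimpleGraph.pathGraph (k + 1)) ![0, Fin.last k] n

/-- Is there a path of some length in `{1, …, k}` between `s` and `t`? -/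
def pathLeST (k n : ℕ) : QueryProblem (EdgeIndex (Fin n)) where
  promise := Set.univ
  yes := {x | ∃ l, 1 ≤ l ∧ l ≤ k ∧ x ∈ (pathEqST l n).yes}

/-- Is there a directed path of length exactly `k`? -/
def dirPathEq (k n : ℕ) : QueryProblem (ArcIndex (Fin n)) :=
  dirSubgraphProblem (dirLine k) ![] n

/-- Is there a directed path of length exactly `k` from `s` to `t`? -/
def dirPathEqST (k n : ℕ) : QueryProblem (ArcIndex (Fin n)) :=
  dirSubgraphProblem (dirLine k) ![0, Fin.last k] n

/-- Is there a directed path of some length in `{1, …, k}` from `s` to `t`? -/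
def dirPathLeST (k n : ℕ) : QueryProblem (ArcIndex (Fin n)) where
  promise := Set.univ
  yes := {x | ∃ l, 1 ≤ l ∧ l ≤ k ∧ x ∈ (dirPathEqST l n).yes}

/-- The problem `P`, restricted to those inputs that satisfy: if there is a directed path of any
length from `s` to `t`, then the answer to `P` is yes. -/
def promDirST {n : ℕ} (P : QueryProblem (ArcIndex (Fin n))) :
    QueryProblem (ArcIndex (Fin n)) where
  promise := {x | x ∈ P.promise ∧ ((∃ l, 1 ≤ l ∧ x ∈ (dirPathEqST l n).yes) → x ∈ P.yes)}
  yes := P.yes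

def promDirPathEqST (k n : ℕ) : QueryProblem (ArcIndex (Fin n)) := promDirST (dirPathEqST k n)

def promDirPathLeST (k n : ℕ) : QueryProblem (ArcIndex (Fin n)) := promDirST (dirPathLeST k n)

/-- The quantum query complexities, as functions of the number `n` of vertices, of the seven
path-containment problems with parameter `k`. -/
noncomputable def pathComplexities (k : ℕ) : Set (ℕ → ℕ) :=
  {fun n => quantumQueryComplexity (dirPathEqST k n),
   fun n => quantumQueryComplexity (dirPathLeST k n),
   fun n => quantumQueryComplexity (promDirPathEqST k n),
   fun n => quantumQueryComplexity (promDirPathLeST k n),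
   fun n => quantumQueryComplexity (pathEqST k n),
   fun n => quantumQueryComplexity (pathLeST k n),
   fun n => quantumQueryComplexity (dirPathEq (k - 2) n)}

/-! Every problem is compared with `dirPathEqST`. Apart from restricting a problem to a promise, all
comparisons go through `exists_quantumQueryComplexity_le`: a randomized reduction with one-sided
error costs only a constant factor if it succeeds with constant probability and each bit of the new
input is a conjunction of boundedly many literals.

Lower bounds come from colour coding. Put `s` in layer `0`, `t` in layer `k`, every other vertex in
a random inner layer, and keep only the arcs from a layer to the next. A given path of length `k`
survives with probability at least `(k-1)^(-(k-1))`, and no path is created. In a layered graph the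
problems become the same question `HasChain`: directed `s`-`t` paths have length exactly `k` (so the
promise is automatic), undirected ones with at most `k` edges must climb at each step, and a path
with `k-2` arcs in the inner layers runs from layer `1` to layer `k-1`, so that its first and last
arcs can also test the connections to `s` and `t`. A path of length `k-p` is first lengthened by `p`
free steps (`paddedArcs`), for a guessed `p`; this covers the problems with length at most `k`. The
outcome is `exists_le_of_detects_chains`.

Upper bounds: a promise only makes a problem easier, an undirected graph is a symmetric directed
one, and a path of length `k-2` becomes an `s`-`t` path of length `k` once `s` is joined to
everything and everything to `t` (`exists_dirPathEq_le`).

On the quantum side, `Reachable` describes circuits on arbitrary registers whose gates are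
controlled by one literal. This model is closed under products and substitution, and agrees with
query algorithms up to a factor of two (`QueryAlgorithm.reachable`, `Reachable.runs`). -/

/-! ## A flexible circuit model for quantum query algorithms -/

/-- The value of a literal, which is an input bit or a constant. -/
def litVal {ι : Type} (x : ι → Bool) : ι ⊕ Bool → Bool := Sum.elim x id

/-- The linear map preserves the standard inner product. -/
def PreservesInner {B : Type} [Fintype B] (V : (B → ℂ) →ₗ[ℂ] (B → ℂ)) : Prop :=
  ∀ φ χ, star (V φ) ⬝ᵥ V χ = star φ ⬝ᵥ χ

/-- The families of states `ψ x` with basis `B` that can be prepared by a circuit with `T` gates that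
depend on the input `x`. Such a gate permutes the basis states, controlled by a literal. -/
inductive Reachable {ι : Type} (B : Type) [Fintype B] : ℕ → ((ι → Bool) → B → ℂ) → Prop
  | init (v : B → ℂ) (hv : star v ⬝ᵥ v = 1) : Reachable B 0 (fun _ => v)
  | unitary {T : ℕ} {ψ : (ι → Bool) → B → ℂ} (V : (B → ℂ) →ₗ[ℂ] (B → ℂ)) (hV : PreservesInner V) :
      Reachable B T ψ → Reachable B T (fun x => V (ψ x))
  | gate {T : ℕ} {ψ : (ι → Bool) → B → ℂ} (q : B → ι ⊕ Bool) (σ : Equiv.Perm B)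
      (hσ : ∀ b, q (σ b) = q b) :
      Reachable B T ψ →
        Reachable B (T + 1) (fun x b => ψ x (if litVal x (q b) = true then σ b else b))

section Lifts

variable {B C : Type} [Fintype B] [Fintype C]

theorem preservesInner_funLeft (σ : Equiv.Perm B) :
    PreservesInner (LinearMap.funLeft ℂ ℂ σ) := by
  intro φ χ
  exact Equiv.sum_comp σ fun b => star φ b * χ b

/-- The action of `V` on the second factor. -/
def liftSnd (C : Type) (V : (B → ℂ) →ₗ[ℂ] (B → ℂ)) : (C × B → ℂ) →ₗ[ℂ] (C × B → ℂ) where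
  toFun φ p := V (fun b => φ (p.1, b)) p.2
  map_add' φ χ := by
    ext p
    exact congrFun (V.map_add (fun b => φ (p.1, b)) (fun b => χ (p.1, b))) p.2
  map_smul' a φ := by
    ext p
    exact congrFun (V.map_smul a (fun b => φ (p.1, b))) p.2

theorem PreservesInner.liftSnd {V : (B → ℂ) →ₗ[ℂ] (B → ℂ)} (hV : PreservesInner V) :
    PreservesInner (liftSnd C V) := by
  intro φ χ
  simp only [dotProduct, Fintype.sum_prod_type]
  exact Finset.sum_congr rfl fun c _ => hV (fun b => φ (c, b)) (fun b => χ (c, b))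

/-- The action of `V` on the first factor. -/
def liftFst (C : Type) (V : (B → ℂ) →ₗ[ℂ] (B → ℂ)) : (B × C → ℂ) →ₗ[ℂ] (B × C → ℂ) where
  toFun φ p := V (fun b => φ (b, p.2)) p.1
  map_add' φ χ := by
    ext p
    exact congrFun (V.map_add (fun b => φ (b, p.2)) (fun b => χ (b, p.2))) p.1
  map_smul' a φ := by
    ext p
    exact congrFun (V.map_smul a (fun b => φ (b, p.2))) p.1

theorem PreservesInner.liftFst {V : (B → ℂ) →ₗ[ℂ] (B → ℂ)} (hV : PreservesInner V) :
    PreservesInner (liftFst C V) := by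
  intro φ χ
  simp only [dotProduct, Fintype.sum_prod_type_right]
  exact Finset.sum_congr rfl fun c _ => hV (fun b => φ (b, c)) (fun b => χ (b, c))

theorem preservesInner_mulVecLin [DecidableEq B] (U : Matrix.unitaryGroup B ℂ) :
    PreservesInner (Matrix.mulVecLin U.1) := by
  intro φ χ
  have h : star U.1 * U.1 = 1 := Matrix.mem_unitaryGroup_iff'.1 U.2
  rw [Matrix.star_eq_conjTranspose] at h
  simp only [Matrix.mulVecLin_apply]
  rw [Matrix.star_mulVec, Matrix.dotProduct_mulVec, Matrix.vecMul_vecMul, h, Matrix.vecMul_one]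

/-- The unitary matrix of a linear map that preserves the inner product. -/
theorem PreservesInner.exists_unitary [DecidableEq B] {V : (B → ℂ) →ₗ[ℂ] (B → ℂ)}
    (hV : PreservesInner V) : ∃ U : Matrix.unitaryGroup B ℂ, ∀ φ, U.1.mulVec φ = V φ := by
  refine ⟨⟨LinearMap.toMatrix' V, ?_⟩, fun φ => LinearMap.toMatrix'_mulVec V φ⟩
  rw [Matrix.mem_unitaryGroup_iff', Matrix.star_eq_conjTranspose]
  ext i j
  have h := hV (Pi.single i 1) (Pi.single j 1)
  simp only [Matrix.mul_apply, Matrix.conjTranspose_apply, LinearMap.toMatrix'_apply]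
  have e : star (Pi.single i (1 : ℂ) : B → ℂ) = Pi.single i 1 := by
    ext b
    by_cases hb : b = i
    · subst hb; simp
    · simp [hb]
  rw [e, single_dotProduct, one_mul, Pi.single_apply] at h
  rw [Matrix.one_apply, ← h]
  rfl

end Lifts

namespace Reachable

variable {ι : Type} {B C : Type} [Fintype B] [Fintype C]

theorem norm_eq {T : ℕ} {ψ : (ι → Bool) → B → ℂ} (h : Reachable B T ψ) (x : ι → Bool) :
    star (ψ x) ⬝ᵥ ψ x = 1 := by
  induction h with
  | init v hv => exact hv
  | unitary V hV _ ih => rw [hV, ih]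
  | @gate T ψ q σ hσ _ ih =>
    rw [← ih]
    have hq : ∀ b, q (σ.symm b) = q b := fun b => by
      rw [← hσ (σ.symm b), Equiv.apply_symm_apply]
    -- The permutation `σ` does not change which literal controls it, so the controlled map is again
    -- a permutation of the basis.
    let τ : Equiv.Perm B :=
      { toFun := fun b => if litVal x (q b) = true then σ b else b
        invFun := fun b => if litVal x (q b) = true then σ.symm b else b
        left_inv := fun b => by
          by_cases hb : litVal x (q b) = true <;> simp [hb, hσ]
        right_inv := fun b => by
          by_cases hb : litVal x (q b) = true <;> simp [hb, hq] }
    exact Equiv.sum_comp τ fun b => star (ψ x) b * ψ x b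

theorem sum_norm_sq {T : ℕ} {ψ : (ι → Bool) → B → ℂ} (h : Reachable B T ψ) (x : ι → Bool) :
    ∑ b, ‖ψ x b‖ ^ 2 = 1 := by
  have h1 := h.norm_eq x
  have h2 : ((∑ b, ‖ψ x b‖ ^ 2 : ℝ) : ℂ) = 1 := by
    rw [← h1]
    push_cast
    exact Finset.sum_congr rfl fun b _ => (Complex.conj_mul' (ψ x b)).symm
  exact_mod_cast h2

theorem permute {T : ℕ} {ψ : (ι → Bool) → B → ℂ} (h : Reachable B T ψ) (σ : Equiv.Perm B) :
    Reachable B T (fun x b => ψ x (σ b)) :=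
  h.unitary _ (preservesInner_funLeft σ)

theorem tensor_init {T : ℕ} {ψ : (ι → Bool) → B → ℂ} (h : Reachable B T ψ) (v : C → ℂ)
    (hv : star v ⬝ᵥ v = 1) : Reachable (B × C) T (fun x p => ψ x p.1 * v p.2) := by
  induction h with
  | init u hu =>
    refine Reachable.init (fun p : B × C => u p.1 * v p.2) ?_
    have e : star (fun p : B × C => u p.1 * v p.2) ⬝ᵥ (fun p : B × C => u p.1 * v p.2) =
        (star u ⬝ᵥ u) * (star v ⬝ᵥ v) := by
      simp only [dotProduct, Fintype.sum_prod_type, Finset.sum_mul_sum, Pi.star_apply, star_mul']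
      exact Finset.sum_congr rfl fun _ _ => Finset.sum_congr rfl fun _ _ => by ring
    rw [e, hu, hv, one_mul]
  | @unitary T ψ V hV _ ih =>
    have h1 := ih.unitary _ (hV.liftFst (C := C))
    refine (congrArg _ ?_).mp h1
    funext x p
    have e : (fun b => ψ x b * v p.2) = v p.2 • ψ x := by
      ext b; simp [mul_comm]
    change V (fun b => ψ x b * v p.2) p.1 = _
    rw [e, map_smul]
    simp [mul_comm]
  | @gate T ψ q σ hσ _ ih =>
    have h1 := ih.gate (fun p => q p.1) (σ.prodCongr (Equiv.refl C)) (fun p => hσ p.1)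
    refine (congrArg _ ?_).mp h1
    funext x p
    by_cases hb : litVal x (q p.1) = true <;> simp [hb]

/-- The first circuit is run to completion next to the initial state of the second; the steps of the
second then act on their own factor, so the gate counts add up. -/
theorem tensor {T₁ T₂ : ℕ} {ψ : (ι → Bool) → B → ℂ} {χ : (ι → Bool) → C → ℂ}
    (h₁ : Reachable B T₁ ψ) (h₂ : Reachable C T₂ χ) :
    Reachable (B × C) (T₁ + T₂) (fun x p => ψ x p.1 * χ x p.2) := by
  induction h₂ with
  | init v hv => exact h₁.tensor_init v hv
  | @unitary T χ V hV _ ih =>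
    have h1 := ih.unitary _ (hV.liftSnd (C := B))
    refine (congrArg _ ?_).mp h1
    funext x p
    change V (ψ x p.1 • χ x) p.2 = _
    rw [map_smul]
    rfl
  | @gate T χ q σ hσ _ ih =>
    have h1 := ih.gate (fun p => q p.2) ((Equiv.refl B).prodCongr σ) (fun p => hσ p.2)
    refine (congrArg _ ?_).mp h1
    funext x p
    by_cases hb : litVal x (q p.2) = true <;> simp [hb]

/-- Add to a register the number of true literals among `h b i`, `i ∈ s`, times `d`. -/
theorem count {G : Type} [Fintype G] [AddCommGroup G] {T m : ℕ} {ψ : (ι → Bool) → B × G → ℂ}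
    (hψ : Reachable (B × G) T ψ) (h : B → Fin m → ι ⊕ Bool) (d : G) (s : Finset (Fin m)) :
    Reachable (B × G) (T + s.card) (fun x p => ψ x
      (p.1, p.2 + ∑ i ∈ s, if litVal x (h p.1 i) = true then d else 0)) := by
  induction s using Finset.induction_on with
  | empty => simpa using hψ
  | insert i s hi ih =>
    have h1 := ih.gate (fun p => h p.1 i) ((Equiv.refl B).prodCongr (Equiv.addRight d))
      (fun p => rfl)
    rw [Finset.card_insert_of_notMem hi, ← add_assoc]
    refine (congrArg _ ?_).mp h1
    funext x p
    rw [Finset.sum_insert hi]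
    by_cases hb : litVal x (h p.1 i) = true <;> simp [hb, add_assoc]

/-- A gate that is controlled by the conjunction of `m` literals. -/
theorem gate_forall {T m : ℕ} {χ : (ι → Bool) → B → ℂ}
    (hχ : Reachable (B × ZMod (m + 1)) T (fun x p => χ x p.1 * if p.2 = 0 then 1 else 0))
    (h : B → Fin m → ι ⊕ Bool) (σ : Equiv.Perm B) (hσ : ∀ b, h (σ b) = h b) :
    Reachable (B × ZMod (m + 1)) (T + 2 * m) (fun x p =>
      χ x (if ∀ i, litVal x (h p.1 i) = true then σ p.1 else p.1) * if p.2 = 0 then 1 else 0) := by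
  let τ : Equiv.Perm (B × ZMod (m + 1)) :=
    { toFun := fun p => (if p.2 = (m : ZMod (m + 1)) then σ p.1 else p.1, p.2)
      invFun := fun p => (if p.2 = (m : ZMod (m + 1)) then σ.symm p.1 else p.1, p.2)
      left_inv := fun p => by
        by_cases hb : p.2 = (m : ZMod (m + 1)) <;> simp [hb]
        exact Prod.ext rfl hb.symm
      right_inv := fun p => by
        by_cases hb : p.2 = (m : ZMod (m + 1)) <;> simp [hb]
        exact Prod.ext rfl hb.symm }
  -- Count the true literals, apply `σ` where the count is `m`, uncount. Gates pull amplitudes back,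
  -- so the shift by `-1` is what increments the counter. The count is at most `m`, so modulo `m +
  -- 1` it equals `m` only if all literals hold.
  have h3 := ((hχ.count h (-1) Finset.univ).permute τ).count h 1 Finset.univ
  have e : T + (Finset.univ : Finset (Fin m)).card + (Finset.univ : Finset (Fin m)).card =
      T + 2 * m := by
    rw [Finset.card_univ, Fintype.card_fin]; ring
  rw [e] at h3
  refine (congrArg _ ?_).mp h3
  funext x p
  obtain ⟨b, c⟩ := p
  have hN : ∀ b, (∑ i, if litVal x (h b i) = true then (1 : ZMod (m + 1)) else 0) =
      ((Finset.univ.filter fun i => litVal x (h b i) = true).card : ZMod (m + 1)) := fun b => by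
    rw [Finset.card_filter]; push_cast; rfl
  have hM : ∀ b, (∑ i, if litVal x (h b i) = true then (-1 : ZMod (m + 1)) else 0) =
      - ∑ i, if litVal x (h b i) = true then (1 : ZMod (m + 1)) else 0 := fun b => by
    rw [← Finset.sum_neg_distrib]
    exact Finset.sum_congr rfl fun i _ => by split_ifs <;> simp
  have hall : (((Finset.univ.filter fun i => litVal x (h b i) = true).card : ZMod (m + 1)) = m) ↔
      ∀ i, litVal x (h b i) = true := by
    have hle : (Finset.univ.filter fun i => litVal x (h b i) = true).card ≤ m := by
      simpa using Finset.card_le_univ (Finset.univ.filter fun i => litVal x (h b i) = true)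
    rw [ZMod.natCast_eq_natCast_iff', Nat.mod_eq_of_lt (by omega), Nat.mod_eq_of_lt (by omega)]
    have := Finset.card_filter_eq_iff (s := (Finset.univ : Finset (Fin m)))
      (p := fun i => litVal x (h b i) = true)
    simpa using this
  simp only [hM, hN, τ, Equiv.coe_fn_mk]
  by_cases hc : c = 0
  · subst hc
    by_cases hb : ∀ i, litVal x (h b i) = true
    · rw [if_pos hb, zero_add, if_pos (hall.2 hb), hσ]
      simp
    · rw [if_neg hb, zero_add, if_neg (fun e => hb (hall.1 e))]
      simp
  · have hz : ∀ b', h b' = h b →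
        c + ((Finset.univ.filter fun i => litVal x (h b i) = true).card : ZMod (m + 1)) +
        -((Finset.univ.filter fun i => litVal x (h b' i) = true).card : ZMod (m + 1)) ≠ 0 := by
      intro b' hb'
      rw [hb']
      simpa using hc
    rw [if_neg hc, mul_zero]
    by_cases h1 : c + ((Finset.univ.filter fun i => litVal x (h b i) = true).card :
        ZMod (m + 1)) = m
    · rw [if_pos h1, if_neg, mul_zero]
      exact hz _ (hσ b)
    · rw [if_neg h1, if_neg (hz b rfl), mul_zero]

/-- Substitute conjunctions of literals, chosen according to a seed `r`, for the input. -/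
theorem substitute {κ : Type} {T m : ℕ} {ψ : (κ → Bool) → B → ℂ} (hψ : Reachable B T ψ)
    {R : Type} [Fintype R] (u : R → ℂ) (hu : star u ⬝ᵥ u = 1)
    (ρ : R → (ι → Bool) → κ → Bool) (h : R → κ → Fin m → ι ⊕ Bool)
    (hm : 0 < m) (hρ : ∀ r x j, ρ r x j = true ↔ ∀ i, litVal x (h r j i) = true) :
    Reachable ((R × B) × ZMod (m + 1)) (2 * m * T)
      (fun x p => (u p.1.1 * ψ (ρ p.1.1 x) p.1.2) * if p.2 = 0 then 1 else 0) := by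
  induction hψ with
  | init v hv =>
    have h1 : Reachable (ι := ι) (R × B) 0 (fun _ p => u p.1 * v p.2) :=
      (Reachable.init u hu).tensor (Reachable.init v hv)
    refine h1.tensor_init (fun c : ZMod (m + 1) => if c = 0 then 1 else 0) ?_
    simp [dotProduct]
  | @unitary T ψ V hV _ ih =>
    have h1 := ih.unitary _ ((hV.liftSnd (C := R)).liftFst (C := ZMod (m + 1)))
    refine (congrArg _ ?_).mp h1
    funext x p
    obtain ⟨⟨r, b⟩, c⟩ := p
    have e : (fun b => (u r * ψ (ρ r x) b) * if c = 0 then 1 else 0) =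
        (u r * if c = 0 then 1 else 0) • ψ (ρ r x) := by
      ext b
      simp only [Pi.smul_apply, smul_eq_mul]
      ring
    change V (fun b => (u r * ψ (ρ r x) b) * if c = 0 then 1 else 0) b = _
    rw [e, map_smul]
    simp only [Pi.smul_apply, smul_eq_mul]
    ring
  | @gate T ψ q σ hσ _ ih =>
    -- A constant control is repeated `m` times. This needs `0 < m`, since an empty conjunction
    -- would turn the constant `false` into `true`.
    have h1 := ih.gate_forall (χ := fun x p => u p.1 * ψ (ρ p.1 x) p.2)
      (fun p => (q p.2).elim (h p.1) fun c _ => Sum.inr c)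
      ((Equiv.refl R).prodCongr σ)
      (fun p => by simp [hσ])
    refine (congrArg _ ?_).mp h1
    funext x p
    obtain ⟨⟨r, b⟩, c⟩ := p
    have e : (∀ i, litVal x ((q b).elim (h r) (fun c _ => Sum.inr c) i) = true) ↔
        litVal (ρ r x) (q b) = true := by
      cases hq : q b with
      | inl j => simpa [litVal] using (hρ r x j).symm
      | inr c =>
        have : Nonempty (Fin m) := ⟨⟨0, hm⟩⟩
        simp [litVal]
    simp only [e]
    by_cases hb : litVal (ρ r x) (q b) = true <;> simp [hb]

end Reachable

/-! ## Realizing circuits by query algorithms -/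

/-- The families of states that query algorithms with workspace `W` reach with `T` queries. -/
inductive Runs {ι : Type} [Fintype ι] [DecidableEq ι] (W : Type) [Fintype W] [DecidableEq W] :
    ℕ → ((ι → Bool) → Option ι × Bool × W → ℂ) → Prop
  | start (p : Option ι × Bool × W) (U : Matrix.unitaryGroup (Option ι × Bool × W) ℂ) :
      Runs W 0 (fun _ => U.1.mulVec (Pi.single p 1))
  | query {T : ℕ} {φ : (ι → Bool) → Option ι × Bool × W → ℂ}
      (U : Matrix.unitaryGroup (Option ι × Bool × W) ℂ) :
      Runs W T φ → Runs W (T + 1) (fun x => U.1.mulVec (QueryAlgorithm.oracle x (φ x)))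

/-- Extend `v` to an orthonormal basis and use it as the columns. This bridges the two models:
circuits start in any unit vector, query algorithms in a basis state. -/
theorem exists_unitary_mulVec_single {N : Type} [Fintype N] [DecidableEq N] (p : N) (v : N → ℂ)
    (hv : star v ⬝ᵥ v = 1) :
    ∃ U : Matrix.unitaryGroup N ℂ, U.1.mulVec (Pi.single p 1) = v := by
  have hin : ∀ a b : EuclideanSpace ℂ N, inner ℂ a b = star a.ofLp ⬝ᵥ b.ofLp := fun a b => by
    rw [EuclideanSpace.inner_eq_star_dotProduct, dotProduct_comm]
  have hn : inner ℂ (WithLp.toLp 2 v : EuclideanSpace ℂ N) (WithLp.toLp 2 v) = 1 := by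
    rw [hin]; exact hv
  have ho : Orthonormal ℂ
      (({p} : Set N).domRestrict fun _ : N => (WithLp.toLp 2 v : EuclideanSpace ℂ N)) := by
    rw [orthonormal_iff_ite]
    intro i j
    rw [if_pos (Subsingleton.elim i j)]
    exact hn
  obtain ⟨b, hb⟩ := ho.exists_orthonormalBasis_extension_of_card_eq (by simp)
  refine ⟨⟨Matrix.of fun i j => (b j) i, ?_⟩, ?_⟩
  · rw [Matrix.mem_unitaryGroup_iff', Matrix.star_eq_conjTranspose]
    ext i j
    rw [Matrix.one_apply, ← orthonormal_iff_ite.1 b.orthonormal i j, hin]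
    rfl
  · ext i
    simp [hb p rfl]

namespace Runs

variable {ι : Type} [Fintype ι] [DecidableEq ι] {W : Type} [Fintype W] [DecidableEq W]

theorem unitary {T : ℕ} {φ : (ι → Bool) → Option ι × Bool × W → ℂ} (h : Runs W T φ)
    (U : Matrix.unitaryGroup (Option ι × Bool × W) ℂ) :
    Runs W T (fun x => U.1.mulVec (φ x)) := by
  cases h with
  | start p V =>
    simp only [Matrix.mulVec_mulVec]
    exact Runs.start p (U * V)
  | query V h =>
    simp only [Matrix.mulVec_mulVec]
    exact h.query (U * V)

theorem permute {T : ℕ} {φ : (ι → Bool) → Option ι × Bool × W → ℂ} (h : Runs W T φ)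
    (σ : Equiv.Perm (Option ι × Bool × W)) : Runs W T (fun x p => φ x (σ p)) := by
  obtain ⟨U, hU⟩ := (preservesInner_funLeft σ).exists_unitary
  have h1 := h.unitary U
  simp only [hU] at h1
  exact h1

theorem oracle {T : ℕ} {φ : (ι → Bool) → Option ι × Bool × W → ℂ} (h : Runs W T φ) :
    Runs W (T + 1) (fun x => QueryAlgorithm.oracle x (φ x)) := by
  simpa using h.query 1

theorem state_congr (A : QueryAlgorithm ι)
    (U : ℕ → Matrix.unitaryGroup (Option ι × Bool × A.W) ℂ) (T : ℕ)
    (hU : ∀ t ≤ T, U t = A.U t) (x : ι → Bool) :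
    QueryAlgorithm.state { A with U := U } x T = A.state x T := by
  induction T with
  | zero =>
    change (U 0).1.mulVec _ = (A.U 0).1.mulVec _
    rw [hU 0 le_rfl]
  | succ T ih =>
    change (U (T + 1)).1.mulVec (QueryAlgorithm.oracle x _) =
      (A.U (T + 1)).1.mulVec (QueryAlgorithm.oracle x _)
    rw [hU (T + 1) le_rfl, ih fun t ht => hU t (by omega)]

/-- The state after `T` queries depends only on `U 0, …, U T`, so a further unitary can be written
at `T + 1` without disturbing the earlier run. -/
theorem exists_state_eq {T : ℕ} {φ : (ι → Bool) → Option ι × Bool × W → ℂ} (h : Runs W T φ) :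
    ∃ (p : Option ι × Bool × W) (U : ℕ → Matrix.unitaryGroup (Option ι × Bool × W) ℂ),
      ∀ out x, QueryAlgorithm.state { W := W, init := p, U := U, out := out } x T = φ x := by
  induction h with
  | start p U => exact ⟨p, fun _ => U, fun _ _ => rfl⟩
  | @query T φ U _ ih =>
    obtain ⟨p, V, hV⟩ := ih
    refine ⟨p, Function.update V (T + 1) U, fun out x => ?_⟩
    have h1 := state_congr { W := W, init := p, U := V, out := out }
      (Function.update V (T + 1) U) T (fun t ht => Function.update_of_ne (by omega) _ _) x
    change (Function.update V (T + 1) U (T + 1)).1.mulVec (QueryAlgorithm.oracle x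
      (QueryAlgorithm.state { W := W, init := p, U := Function.update V (T + 1) U, out := out }
        x T)) = _
    rw [Function.update_self, h1.trans (hV out x)]

end Runs

section Conversion

variable {ι : Type} [Fintype ι] [DecidableEq ι] {W : Type} [Fintype W] [DecidableEq W]

/-- The state `|none⟩|0⟩ ⊗ φ`. -/
def idleState (ι : Type) [DecidableEq ι] {W : Type} (φ : W → ℂ) : Option ι × Bool × W → ℂ :=
  fun p => if p.1 = none ∧ p.2.1 = false then φ p.2.2 else 0

/-- Bring the index that the literal `q w` asks for to the query register, or remove it. -/
def loadIndex (q : W → ι ⊕ Bool) : Equiv.Perm (Option ι × Bool × W) :=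
  Function.Involutive.toPerm
    (fun p => (Equiv.swap none ((q p.2.2).elim some fun _ => none) p.1, p.2.1, p.2.2))
    (fun p => by simp)

/-- The value of a literal, computed from the answer register. -/
def answer (b : Bool) : ι ⊕ Bool → Bool := Sum.elim (fun _ => b) id

/-- Apply `σ` to the workspace if the answer register says that the literal is true. -/
def applyAnswer (q : W → ι ⊕ Bool) (σ : Equiv.Perm W) (hσ : ∀ w, q (σ w) = q w) :
    Equiv.Perm (Option ι × Bool × W) where
  toFun p := (p.1, p.2.1, if answer p.2.1 (q p.2.2) = true then σ p.2.2 else p.2.2)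
  invFun p := (p.1, p.2.1, if answer p.2.1 (q p.2.2) = true then σ.symm p.2.2 else p.2.2)
  left_inv p := by
    by_cases hb : answer p.2.1 (q p.2.2) = true <;> simp [hb, hσ]
  right_inv p := by
    have hq : q (σ.symm p.2.2) = q p.2.2 := by
      rw [← hσ (σ.symm p.2.2), Equiv.apply_symm_apply]
    by_cases hb : answer p.2.1 (q p.2.2) = true <;> simp [hb, hq]

theorem Reachable.runs {T : ℕ} {ψ : (ι → Bool) → W → ℂ} (h : Reachable W T ψ) :
    Runs W (2 * T) (fun x => idleState ι (ψ x)) := by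
  have hsum : ∀ f : Option ι × Bool × W → ℂ, (∀ i b w, ¬ (i = none ∧ b = false) → f (i, b, w) = 0) →
      ∑ p, f p = ∑ w, f (none, false, w) := by
    intro f hf
    rw [Fintype.sum_prod_type, Fintype.sum_option, Fintype.sum_prod_type, Fintype.sum_bool]
    simp [hf]
  induction h with
  | init v hv =>
    have hne : Nonempty W := by
      by_contra hW
      rw [not_nonempty_iff] at hW
      simp [dotProduct] at hv
    obtain ⟨w⟩ := hne
    obtain ⟨U, hU⟩ := exists_unitary_mulVec_single (none, false, w) (idleState ι v) (by
      rw [← hv]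
      refine (hsum _ ?_).trans ?_
      · intro i b w h
        simp [idleState, h]
      · simp [idleState, dotProduct])
    have h1 := Runs.start (ι := ι) (W := W) (none, false, w) U
    rw [hU] at h1
    exact h1
  | @unitary T ψ V hV _ ih =>
    obtain ⟨U, hU⟩ := ((hV.liftSnd (C := Bool)).liftSnd (C := Option ι)).exists_unitary
    have h1 := ih.unitary U
    simp only [hU] at h1
    refine (congrArg _ ?_).mp h1
    funext x p
    obtain ⟨i, b, w⟩ := p
    change V (fun w => if i = none ∧ b = false then ψ x w else 0) w = _
    by_cases hi : i = none ∧ b = false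
    · simp only [idleState, if_pos hi]
    · simp only [idleState, if_neg hi]
      exact congrFun V.map_zero w
  | @gate T ψ q σ hσ _ ih =>
    -- Load the index, query, apply `σ` if the literal is true, query again to erase the answer,
    -- unload the index. The second half undoes the first because `σ` preserves `q`. Constant
    -- literals make idle queries.
    have h1 := (((ih.permute (loadIndex q)).oracle.permute (applyAnswer q σ hσ)).oracle.permute
      (loadIndex q))
    refine (congrArg _ ?_).mp h1
    funext x p
    obtain ⟨i, b, w⟩ := p
    have hqσ := hσ w
    cases hq : q w with
    | inl j =>
      rw [hq] at hqσ
      by_cases hj : i = some j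
      · subst hj
        cases b <;> cases hx : x j <;>
          simp [QueryAlgorithm.oracle, idleState, loadIndex, applyAnswer, answer, hq, hqσ]
      · cases i with
        | none =>
          cases b <;> cases hx : x j <;>
            simp [QueryAlgorithm.oracle, idleState, loadIndex, applyAnswer, answer, litVal,
              hq, hqσ, hx]
        | some i =>
          have hs : Equiv.swap none (some j) (some i) = some i :=
            Equiv.swap_apply_of_ne_of_ne (by simp) hj
          cases hb : xor b (x i) <;>
            simp [QueryAlgorithm.oracle, idleState, loadIndex, applyAnswer, answer,
              hq, hqσ, hb, hs]
    | inr c =>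
      rw [hq] at hqσ
      cases i <;> cases c <;>
        simp [QueryAlgorithm.oracle, idleState, loadIndex, applyAnswer, answer, litVal, hq, hqσ]

/-- The algorithm can be run with `T` gates of the flexible model. -/
theorem QueryAlgorithm.reachable (A : QueryAlgorithm ι) (T : ℕ) :
    Reachable (Option ι × Bool × A.W) T (fun x => A.state x T) := by
  induction T with
  | zero =>
    refine (Reachable.init (Pi.single A.init (1 : ℂ)) ?_).unitary _
      (preservesInner_mulVecLin (A.U 0))
    simp [dotProduct, Pi.single_apply]
  | succ T ih =>
    have h1 := (ih.gate (fun p => p.1.elim (Sum.inr false) Sum.inl)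
      ((Equiv.refl (Option ι)).prodCongr ((Equiv.boolNot).prodCongr (Equiv.refl A.W)))
      (fun p => rfl)).unitary _ (preservesInner_mulVecLin (A.U (T + 1)))
    refine (congrArg _ ?_).mp h1
    funext x
    change (A.U (T + 1)).1.mulVec _ = (A.U (T + 1)).1.mulVec _
    congr 1
    funext p
    obtain ⟨i | i, b, w⟩ := p
    · simp [QueryAlgorithm.oracle, litVal]
    · cases hb : x i <;> simp [QueryAlgorithm.oracle, litVal, hb, Equiv.boolNot]

end Conversion

/-! ## Acceptance probabilities -/

/-- `p x` is the acceptance probability on `x` of some circuit with `T` input-dependent gates. -/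
def IsAcceptProb {ι : Type} (T : ℕ) (p : (ι → Bool) → ℝ) : Prop :=
  ∃ (B : Type) (_ : Fintype B) (_ : DecidableEq B) (ψ : (ι → Bool) → B → ℂ) (out : B → Bool),
    Reachable B T ψ ∧ ∀ x, p x = ∑ b, if out b = true then ‖ψ x b‖ ^ 2 else 0

namespace IsAcceptProb

variable {ι : Type} {S T : ℕ} {p q : (ι → Bool) → ℝ}

theorem nonneg (h : IsAcceptProb T p) (x : ι → Bool) : 0 ≤ p x := by
  obtain ⟨B, _, _, ψ, out, _, hp⟩ := h
  rw [hp]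
  exact Finset.sum_nonneg fun b _ => by positivity

theorem compl (h : IsAcceptProb T p) : IsAcceptProb T (fun x => 1 - p x) := by
  obtain ⟨B, _, _, ψ, out, hψ, hp⟩ := h
  refine ⟨B, _, ‹_›, ψ, fun b => !out b, hψ, fun x => ?_⟩
  simp only [hp]
  rw [← hψ.sum_norm_sq x, ← Finset.sum_sub_distrib]
  exact Finset.sum_congr rfl fun b _ => by by_cases hb : out b = true <;> simp [hb]

theorem le_one (h : IsAcceptProb T p) (x : ι → Bool) : p x ≤ 1 := by
  linarith [h.compl.nonneg x]

theorem mul (hp : IsAcceptProb S p) (hq : IsAcceptProb T q) :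
    IsAcceptProb (S + T) (fun x => p x * q x) := by
  obtain ⟨B, _, _, ψ, out, hψ, hp⟩ := hp
  obtain ⟨C, _, _, χ, out', hχ, hq⟩ := hq
  refine ⟨B × C, inferInstance, inferInstance, _, fun b => out b.1 && out' b.2,
    hψ.tensor hχ, fun x => ?_⟩
  simp only [hp, hq]
  rw [Finset.sum_mul_sum, Fintype.sum_prod_type]
  refine Finset.sum_congr rfl fun b _ => Finset.sum_congr rfl fun c _ => ?_
  by_cases hb : out b = true <;> by_cases hc : out' c = true <;> simp [hb, hc, mul_pow]

theorem one : IsAcceptProb (ι := ι) 0 (fun _ => 1) :=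
  ⟨Unit, inferInstance, inferInstance, _, fun _ => true,
    Reachable.init (fun _ => 1) (by simp [dotProduct]), fun x => by simp⟩

theorem pow (hp : IsAcceptProb T p) (a : ℕ) : IsAcceptProb (a * T) (fun x => p x ^ a) := by
  induction a with
  | zero => simpa using one
  | succ a ih => simpa [pow_succ, Nat.succ_mul] using ih.mul hp

/-- Accept if at least one of `a` repetitions accepts. -/
theorem repeated (hp : IsAcceptProb T p) (a : ℕ) :
    IsAcceptProb (a * T) (fun x => 1 - (1 - p x) ^ a) :=
  (hp.compl.pow a).compl

/-- Run the circuit with conjunctions of literals as inputs, chosen according to a random seed. -/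
theorem average {κ : Type} {p : (κ → Bool) → ℝ} (hp : IsAcceptProb T p) {m : ℕ} (hm : 0 < m)
    {R : Type} [Fintype R] [Nonempty R] (ρ : R → (ι → Bool) → κ → Bool)
    (hρ : ∀ r j, ∃ h : Fin m → ι ⊕ Bool, ∀ x,
      ρ r x j = true ↔ ∀ i, litVal x (h i) = true) :
    IsAcceptProb (2 * m * T) (fun x => (∑ r, p (ρ r x)) / Fintype.card R) := by
  classical
  obtain ⟨B, _, _, ψ, out, hψ, hp⟩ := hp
  choose h hh using hρ
  have hR : (0 : ℝ) < Fintype.card R := by exact_mod_cast Fintype.card_pos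
  have hs : ‖((1 / Real.sqrt (Fintype.card R) : ℝ) : ℂ)‖ ^ 2 = 1 / Fintype.card R := by
    rw [Complex.norm_real, Real.norm_eq_abs, sq_abs, div_pow, one_pow, Real.sq_sqrt hR.le]
  have hu : star (fun _ : R => ((1 / Real.sqrt (Fintype.card R) : ℝ) : ℂ)) ⬝ᵥ
      (fun _ : R => ((1 / Real.sqrt (Fintype.card R) : ℝ) : ℂ)) = 1 := by
    have e : star ((1 / Real.sqrt (Fintype.card R) : ℝ) : ℂ) *
        ((1 / Real.sqrt (Fintype.card R) : ℝ) : ℂ) = ((1 / Fintype.card R : ℝ) : ℂ) := by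
      rw [← hs]
      exact (Complex.conj_mul' _).trans (by push_cast; rfl)
    simp only [dotProduct, Pi.star_apply]
    rw [Finset.sum_const, e, Finset.card_univ, nsmul_eq_mul]
    push_cast
    exact mul_one_div_cancel (by exact_mod_cast hR.ne')
  -- The seed is in uniform superposition and is never altered, so it acts like a random choice; the
  -- counter register has returned to `0`.
  refine ⟨_, inferInstance, inferInstance, _, fun b => out b.1.2,
    hψ.substitute _ hu ρ h hm (fun r x j => hh r j x), fun x => ?_⟩
  simp only []
  rw [Fintype.sum_prod_type, Fintype.sum_prod_type, Finset.sum_div]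
  refine Finset.sum_congr rfl fun r _ => ?_
  rw [hp, Finset.sum_div]
  refine Finset.sum_congr rfl fun b _ => ?_
  rw [Finset.sum_eq_single 0 (fun c _ hc => by simp [hc]) (by simp)]
  simp only [if_true, mul_one, norm_mul, mul_pow, hs]
  split_ifs
  · ring
  · simp

variable [Fintype ι] [DecidableEq ι]

theorem exists_solves (hp : IsAcceptProb T p) {P : QueryProblem ι}
    (hyes : ∀ x ∈ P.promise, x ∈ P.yes → 2 / 3 ≤ p x)
    (hno : ∀ x ∈ P.promise, x ∉ P.yes → p x ≤ 1 / 3) :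
    ∃ A : QueryAlgorithm ι, A.Solves (2 * T) P := by
  obtain ⟨B, _, _, ψ, out, hψ, hp⟩ := hp
  obtain ⟨p₀, U, hU⟩ := hψ.runs.exists_state_eq
  have hout : ∀ x c, QueryAlgorithm.outputProb
      { W := B, init := p₀, U := U, out := fun b => out b.2.2 } (2 * T) x c =
      ∑ b, if out b = c then ‖ψ x b‖ ^ 2 else 0 := by
    intro x c
    unfold QueryAlgorithm.outputProb
    rw [hU]
    refine (Fintype.sum_prod_type _).trans ?_
    rw [Fintype.sum_option, Fintype.sum_prod_type, Fintype.sum_bool]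
    simp [idleState]
  have hno' : ∀ x, (∑ b, if out b = false then ‖ψ x b‖ ^ 2 else 0) = 1 - p x := by
    intro x
    rw [hp, ← hψ.sum_norm_sq x, ← Finset.sum_sub_distrib]
    exact Finset.sum_congr rfl fun b _ => by cases out b <;> simp
  refine ⟨{ W := B, init := p₀, U := U, out := fun b => out b.2.2 },
    fun x hx => ⟨fun h => ?_, fun h => ?_⟩⟩
  · rw [hout, ← hp]
    exact hyes x hx h
  · rw [hout, hno']
    linarith [hno x hx h]

end IsAcceptProb

theorem QueryAlgorithm.isAcceptProb {ι : Type} [Fintype ι] [DecidableEq ι] (A : QueryAlgorithm ι)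
    (T : ℕ) : IsAcceptProb T (fun x => A.outputProb T x true) :=
  ⟨_, inferInstance, inferInstance, _, A.out, A.reachable T, fun _ => rfl⟩

theorem exists_solves_quantumQueryComplexity {ι : Type} [Fintype ι] [DecidableEq ι]
    (P : QueryProblem ι) : ∃ A : QueryAlgorithm ι, A.Solves (quantumQueryComplexity P) P :=
  Nat.sInf_mem (s := {T : ℕ | ∃ A : QueryAlgorithm ι, A.Solves T P})
    (exists_queryAlgorithm_solves P)

/-! ## Randomized reductions with one-sided error -/

/-- An AND of `a` runs followed by an OR of about `(3/2)^a` such blocks replaces a majority vote. If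
`p ≥ 2/3`, all blocks fail with probability at most `1/e`; if `p ≤ 1/3`, Bernoulli's inequality
bounds the acceptance by `2 (3/2)^a (1/3)^a = 2 / 2^a`. -/
theorem exists_amplification {ε : ℝ} (hε : 0 < ε) : ∃ a b : ℕ, ∀ p : ℝ, 0 ≤ p → p ≤ 1 →
    (2 / 3 ≤ p → 1 / 2 ≤ 1 - (1 - p ^ a) ^ b) ∧ (p ≤ 1 / 3 → 1 - (1 - p ^ a) ^ b ≤ ε) := by
  obtain ⟨a, ha⟩ := exists_pow_lt_of_lt_one (half_pos hε) (by norm_num : (1 / 2 : ℝ) < 1)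
  refine ⟨a, ⌈(3 / 2 : ℝ) ^ a⌉₊, fun p h0 h1 => ⟨fun hp => ?_, fun hp => ?_⟩⟩
  · have h2 : (2 / 3 : ℝ) ^ a ≤ p ^ a := pow_le_pow_left₀ (by norm_num) hp a
    have h3 : p ^ a ≤ 1 := pow_le_one₀ h0 h1
    have h4 : 1 - p ^ a ≤ Real.exp (-(2 / 3 : ℝ) ^ a) := by
      have := Real.add_one_le_exp (-(2 / 3 : ℝ) ^ a)
      linarith
    have h5 : (1 - p ^ a) ^ ⌈(3 / 2 : ℝ) ^ a⌉₊ ≤ Real.exp (-1) := by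
      refine (pow_le_pow_left₀ (by linarith) h4 _).trans ?_
      rw [← Real.exp_nat_mul, Real.exp_le_exp]
      have h6 := mul_le_mul_of_nonneg_right (Nat.le_ceil ((3 / 2 : ℝ) ^ a))
        (by positivity : (0 : ℝ) ≤ (2 / 3 : ℝ) ^ a)
      rw [← mul_pow] at h6
      norm_num at h6 ⊢
      linarith
    have h7 := Real.exp_neg_one_lt_half
    linarith
  · have h2 : p ^ a ≤ (1 / 3 : ℝ) ^ a := pow_le_pow_left₀ h0 hp a
    have h3 : p ^ a ≤ 1 := pow_le_one₀ h0 h1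
    have h4 := one_add_mul_le_pow (by linarith : (-2 : ℝ) ≤ -p ^ a) ⌈(3 / 2 : ℝ) ^ a⌉₊
    rw [← sub_eq_add_neg] at h4
    have h5 : (⌈(3 / 2 : ℝ) ^ a⌉₊ : ℝ) ≤ 2 * (3 / 2 : ℝ) ^ a := by
      have := (Nat.ceil_lt_add_one (by positivity : (0 : ℝ) ≤ (3 / 2 : ℝ) ^ a)).le
      have := one_le_pow₀ (by norm_num : (1 : ℝ) ≤ 3 / 2) (n := a)
      linarith
    have h6 : (⌈(3 / 2 : ℝ) ^ a⌉₊ : ℝ) * p ^ a ≤ 2 * (3 / 2 : ℝ) ^ a * (1 / 3 : ℝ) ^ a :=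
      mul_le_mul h5 h2 (by positivity) (by positivity)
    rw [mul_assoc, ← mul_pow] at h6
    norm_num at h6 ha
    linarith

/-- If every member of `P` is mapped to a member of `P'` with probability at least `δ`, and every
nonmember is always mapped to a nonmember, where the map replaces the input bits by conjunctions of
`m` literals, then `P` is at most by a constant factor harder than `P'`. -/
theorem exists_quantumQueryComplexity_le {δ : ℝ} (hδ : 0 < δ) {m : ℕ} (hm : 0 < m) :
    ∃ K : ℕ, ∀ {ι κ R : Type} [Fintype ι] [DecidableEq ι] [Fintype κ] [DecidableEq κ] [Fintype R]
      [Nonempty R] (P : QueryProblem ι) (P' : QueryProblem κ) (ρ : R → (ι → Bool) → κ → Bool),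
      (∀ r j, ∃ h : Fin m → ι ⊕ Bool, ∀ x, ρ r x j = true ↔ ∀ i, litVal x (h i) = true) →
      (∀ x ∈ P.promise, x ∈ P.yes → ∃ G : Finset R, δ * Fintype.card R ≤ G.card ∧
        ∀ r ∈ G, ρ r x ∈ P'.promise ∧ ρ r x ∈ P'.yes) →
      (∀ x ∈ P.promise, x ∉ P.yes → ∀ r, ρ r x ∈ P'.promise ∧ ρ r x ∉ P'.yes) →
      quantumQueryComplexity P ≤ K * quantumQueryComplexity P' := by
  wlog hδ1 : δ ≤ 1 generalizing δ
  · obtain ⟨K, hK⟩ := this one_pos le_rfl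
    refine ⟨K, fun P P' ρ h1 h2 h3 => hK P P' ρ h1 (fun x hx hy => ?_) h3⟩
    obtain ⟨G, hG, hG'⟩ := h2 x hx hy
    exact ⟨G, le_trans (mul_le_mul_of_nonneg_right (le_of_not_ge hδ1) (by positivity)) hG, hG'⟩
  -- After amplification a yes-instance is accepted with probability at least `δ/2`, so `M`
  -- repetitions fail with probability below `1/3`. On no-instances the error `1/(3(M+1))` per
  -- repetition adds up to at most `1/3`.
  obtain ⟨M, hM⟩ := exists_pow_lt_of_lt_one (by norm_num : (0 : ℝ) < 1 / 3)
    (by linarith : 1 - δ / 2 < 1)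
  obtain ⟨a, b, hab⟩ := exists_amplification (by positivity : (0 : ℝ) < 1 / (3 * (M + 1)))
  -- Two queries per gate, `M` repetitions, `2m` gates for each substituted one, and `b * a` runs
  -- for the amplification.
  refine ⟨2 * (M * (2 * m * (b * a))), fun {ι κ R} _ _ _ _ _ _ P P' ρ hρ hyes hno => ?_⟩
  obtain ⟨A, hA⟩ := exists_solves_quantumQueryComplexity P'
  have h1 := A.isAcceptProb (quantumQueryComplexity P')
  have h2 := (h1.pow a).repeated b
  have h3 := h2.average hm ρ hρ
  have hR : (0 : ℝ) < Fintype.card R := by exact_mod_cast Fintype.card_pos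
  have hcompl : ∀ y, A.outputProb (quantumQueryComplexity P') y true =
      1 - A.outputProb (quantumQueryComplexity P') y false := by
    intro y
    rw [← (A.reachable (quantumQueryComplexity P')).sum_norm_sq y]
    unfold QueryAlgorithm.outputProb
    rw [← Finset.sum_sub_distrib]
    exact Finset.sum_congr rfl fun p _ => by cases A.out p <;> simp
  suffices h : ∃ A' : QueryAlgorithm ι, A'.Solves
      (2 * (M * (2 * m * (b * (a * quantumQueryComplexity P'))))) P by
    obtain ⟨A', hA'⟩ := h
    refine (Nat.sInf_le (m := 2 * (M * (2 * m * (b * (a * quantumQueryComplexity P')))))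
      (s := {T : ℕ | ∃ A : QueryAlgorithm ι, A.Solves T P}) ⟨A', hA'⟩).trans (le_of_eq ?_)
    ring
  refine (h3.repeated M).exists_solves ?_ ?_
  · intro x hx hxy
    obtain ⟨G, hG, hG'⟩ := hyes x hx hxy
    have hge : δ / 2 ≤ (∑ r, (1 - (1 - A.outputProb (quantumQueryComplexity P') (ρ r x) true ^ a) ^ b)) /
        Fintype.card R := by
      rw [le_div_iff₀ hR]
      have h4 : ∑ _r ∈ G, (1 / 2 : ℝ) ≤
          ∑ r ∈ G, (1 - (1 - A.outputProb (quantumQueryComplexity P') (ρ r x) true ^ a) ^ b) :=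
        Finset.sum_le_sum fun r hr => (hab _ (h1.nonneg _) (h1.le_one _)).1
          ((hA _ (hG' r hr).1).1 (hG' r hr).2)
      have h5 := Finset.sum_le_sum_of_subset_of_nonneg (Finset.subset_univ G)
        fun r _ _ => h2.nonneg (ρ r x)
      rw [Finset.sum_const, nsmul_eq_mul] at h4
      linarith
    have h6 := pow_le_pow_left₀ (sub_nonneg.2 (h3.le_one x))
      (sub_le_sub_left hge 1) M
    linarith
  · intro x hx hxy
    have hle : (∑ r, (1 - (1 - A.outputProb (quantumQueryComplexity P') (ρ r x) true ^ a) ^ b)) /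
        Fintype.card R ≤ 1 / (3 * (M + 1)) := by
      rw [div_le_iff₀ hR]
      refine (Finset.sum_le_sum fun r _ => (hab _ (h1.nonneg (ρ r x)) (h1.le_one _)).2 ?_).trans ?_
      · have := (hA _ (hno x hx hxy r).1).2 (hno x hx hxy r).2
        rw [hcompl]
        linarith
      · rw [Finset.sum_const, nsmul_eq_mul, Finset.card_univ, mul_comm]
    have h4 := h3.nonneg x
    have h7 := h3.le_one x
    have h5 := one_add_mul_le_pow (by linarith : (-2 : ℝ) ≤
      -((∑ r, (1 - (1 - A.outputProb (quantumQueryComplexity P') (ρ r x) true ^ a) ^ b)) /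
        Fintype.card R)) M
    rw [← sub_eq_add_neg] at h5
    have h6 : (M : ℝ) * ((∑ r, (1 - (1 - A.outputProb (quantumQueryComplexity P') (ρ r x) true ^ a) ^ b)) /
        Fintype.card R) ≤ 1 / 3 := by
      refine (mul_le_mul_of_nonneg_left hle (by positivity)).trans ?_
      rw [mul_one_div, div_le_div_iff₀ (by positivity) (by norm_num)]
      linarith
    linarith

/-! ## Paths as sequences of vertices -/

/-- The vertices `v 0, …, v l` are distinct, and `E` holds for consecutive ones. -/
def IsPath {V : Type} (E : V → V → Prop) (l : ℕ) (v : ℕ → V) : Prop :=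
  Set.InjOn v (Set.Iic l) ∧ ∀ i < l, E (v i) (v (i + 1))

/-- A path of length `l` from the vertex `0` to the vertex `1`. -/
def IsPathST {n : ℕ} (E : Fin n → Fin n → Prop) (l : ℕ) (v : ℕ → Fin n) : Prop :=
  IsPath E l v ∧ (v 0 : ℕ) = 0 ∧ (v l : ℕ) = 1

/-- Sequences on `ℕ` allow shifting and splicing of paths without casts; their values beyond `l` are
irrelevant. The relation `Q` holds the condition on the end vertices and is trivial for free paths.
-/
theorem exists_embedding_iff {V : Type} (l : ℕ) (E : V → V → Prop) (Q : V → V → Prop) :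
    (∃ φ : Fin (l + 1) ↪ V, Q (φ 0) (φ (Fin.last l)) ∧
      ∀ a b : Fin (l + 1), (a : ℕ) + 1 = b → E (φ a) (φ b)) ↔
    ∃ v, IsPath E l v ∧ Q (v 0) (v l) := by
  constructor
  · rintro ⟨φ, hQ, hE⟩
    refine ⟨fun i => φ ⟨min i l, by omega⟩, ⟨fun i hi j hj h => ?_, fun i hi => hE _ _ ?_⟩, ?_⟩
    · have := congrArg Fin.val (φ.injective h)
      simp only [Set.mem_Iic] at hi hj
      simp only [] at this
      omega
    · simp only []
      omega
    · have h0 : (⟨min 0 l, by omega⟩ : Fin (l + 1)) = 0 := Fin.ext (by simp)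
      have h1 : (⟨min l l, by omega⟩ : Fin (l + 1)) = Fin.last l := Fin.ext (by simp)
      simpa only [h0, h1] using hQ
  · rintro ⟨v, ⟨hv, hE⟩, hQ⟩
    refine ⟨⟨fun i => v i, fun i j h => Fin.ext (hv ?_ ?_ h)⟩, hQ, fun a b hab => ?_⟩
    · exact Nat.lt_succ_iff.1 i.2
    · exact Nat.lt_succ_iff.1 j.2
    · have h1 := hE a (by omega)
      rw [hab] at h1
      exact h1

theorem mem_dirPathEqST_yes {l n : ℕ} {x : ArcIndex (Fin n) → Bool} :
    x ∈ (dirPathEqST l n).yes ↔ ∃ v, IsPathST (digraphOf x).Adj l v := by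
  rw [show (∃ v, IsPathST (digraphOf x).Adj l v) ↔ _ from
    (exists_embedding_iff l (digraphOf x).Adj fun a b => (a : ℕ) = 0 ∧ (b : ℕ) = 1).symm]
  simp [dirPathEqST, dirSubgraphProblem, dirLine, Fin.forall_fin_two]

theorem mem_dirPathEq_yes {l n : ℕ} {x : ArcIndex (Fin n) → Bool} :
    x ∈ (dirPathEq l n).yes ↔ ∃ v, IsPath (digraphOf x).Adj l v := by
  have h := exists_embedding_iff l (digraphOf x).Adj fun _ _ => True
  simp only [and_true, true_and] at h
  rw [← h]
  simp [dirPathEq, dirSubgraphProblem, dirLine]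

theorem mem_pathEqST_yes {l n : ℕ} {x : EdgeIndex (Fin n) → Bool} :
    x ∈ (pathEqST l n).yes ↔ ∃ v, IsPathST (graphOf x).Adj l v := by
  rw [show (∃ v, IsPathST (graphOf x).Adj l v) ↔ _ from
    (exists_embedding_iff l (graphOf x).Adj fun a b => (a : ℕ) = 0 ∧ (b : ℕ) = 1).symm]
  simp only [pathEqST, subgraphProblem, Set.mem_ofPred_eq, Fin.forall_fin_two,
    SimpleGraph.pathGraph_adj]
  refine exists_congr fun φ => and_congr (by simp) ⟨fun h a b hab => h a b (Or.inl hab), ?_⟩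
  rintro h a b (hab | hab)
  · exact h a b hab
  · exact (h b a hab).symm

/-! ## Layered graphs -/

/-- The layer of a vertex: `0` and `1` form the layers `0` and `k`, and the colouring `c` divides the
other vertices among the layers `1, …, k - 1`. -/
def layer {k n : ℕ} (c : Fin n → Fin (k - 1)) (u : Fin n) : ℕ :=
  if (u : ℕ) = 0 then 0 else if (u : ℕ) = 1 then k else c u + 1

/-- There is a sequence of vertices, one from each layer, where `w` holds for consecutive ones. -/
def HasChain {n : ℕ} (k : ℕ) (L : Fin n → ℕ) (w : Fin n × Fin n → Bool) : Prop :=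
  ∃ v : ℕ → Fin n, (∀ i ≤ k, L (v i) = i) ∧ ∀ i < k, w (v i, v (i + 1)) = true

section Layers

variable {k n : ℕ} (c : Fin n → Fin (k - 1))

theorem layer_eq_zero (hk : 0 < k) {u : Fin n} : layer c u = 0 ↔ (u : ℕ) = 0 := by
  unfold layer
  split_ifs <;> simp_all
  omega

theorem layer_eq_last {u : Fin n} (hk : 0 < k) : layer c u = k ↔ (u : ℕ) = 1 := by
  have := (c u).isLt
  unfold layer
  split_ifs <;> omega

theorem injOn_of_layer {L : Fin n → ℕ} {l a : ℕ} {v : ℕ → Fin n} (h : ∀ i ≤ l, L (v i) = i + a) :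
    Set.InjOn v (Set.Iic l) := by
  intro i hi j hj hij
  have h1 := h i hi
  rw [hij, h j hj] at h1
  omega

/-- Every arc climbs exactly one layer, and the ends lie in the layers `0` and `k`. -/
theorem layered_path (hk : 0 < k) {E : Fin n → Fin n → Prop} {w : Fin n × Fin n → Bool}
    (hE : ∀ u v, E u v ↔ layer c v = layer c u + 1 ∧ w (u, v) = true) {l : ℕ} {v : ℕ → Fin n}
    (hv : IsPathST E l v) : l = k ∧ HasChain k (layer c) w := by
  obtain ⟨⟨_, hp⟩, h0, h1⟩ := hv
  have hL : ∀ i ≤ l, layer c (v i) = i := by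
    intro i hi
    induction i with
    | zero => exact (layer_eq_zero c hk).2 h0
    | succ i ih => rw [((hE _ _).1 (hp i (by omega))).1, ih (by omega)]
  have hl : l = k := (hL l le_rfl).symm.trans ((layer_eq_last c hk).2 h1)
  subst hl
  exact ⟨rfl, v, hL, fun i hi => ((hE _ _).1 (hp i hi)).2⟩

/-- An edge changes the layer by at most one, so getting from layer `0` to layer `k` within `k`
edges leaves no room for a step down. The bounds `hle` and `hge`, from the two ends, pin down the
layer of each vertex. -/
theorem layered_path_symm (hk : 0 < k) {E : Fin n → Fin n → Prop} {w : Fin n × Fin n → Bool}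
    (hE : ∀ u v, E u v ↔ (layer c v = layer c u + 1 ∧ w (u, v) = true) ∨
      (layer c u = layer c v + 1 ∧ w (v, u) = true)) {l : ℕ} (hl : l ≤ k) {v : ℕ → Fin n}
    (hv : IsPathST E l v) : l = k ∧ HasChain k (layer c) w := by
  obtain ⟨⟨_, hp⟩, h0, h1⟩ := hv
  have hstep : ∀ i < l, layer c (v (i + 1)) ≤ layer c (v i) + 1 := by
    intro i hi
    rcases (hE _ _).1 (hp i hi) with h | h <;> omega
  have hle : ∀ i ≤ l, layer c (v i) ≤ i := by
    intro i hi
    induction i with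
    | zero => exact ((layer_eq_zero c hk).2 h0).le
    | succ i ih =>
      have := hstep i (by omega)
      have := ih (by omega)
      omega
  have hge : ∀ j ≤ l, k ≤ layer c (v (l - j)) + j := by
    intro j hj
    induction j with
    | zero => exact ((layer_eq_last c hk).2 h1).ge
    | succ j ih =>
      have h2 := hstep (l - (j + 1)) (by omega)
      rw [show l - (j + 1) + 1 = l - j by omega] at h2
      have := ih (by omega)
      omega
  have hlk : l = k := by
    have h2 := hge l le_rfl
    rw [Nat.sub_self, (layer_eq_zero c hk).2 h0] at h2
    omega
  subst hlk
  have hL : ∀ i ≤ l, layer c (v i) = i := by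
    intro i hi
    have h2 := hge (l - i) (by omega)
    rw [show l - (l - i) = i by omega] at h2
    have := hle i hi
    omega
  refine ⟨rfl, v, hL, fun i hi => ?_⟩
  rcases (hE _ _).1 (hp i hi) with h | h
  · exact h.2
  · have := hL i hi.le
    have := hL (i + 1) hi
    omega

theorem HasChain.exists_isPathST (hk : 0 < k) {E : Fin n → Fin n → Prop}
    {w : Fin n × Fin n → Bool} (h : HasChain k (layer c) w)
    (hE : ∀ u v, layer c v = layer c u + 1 → w (u, v) = true → E u v) :
    ∃ v, IsPathST E k v := by
  obtain ⟨v, hL, hw⟩ := h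
  refine ⟨v, ⟨injOn_of_layer (a := 0) hL, fun i hi => hE _ _ ?_ (hw i hi)⟩,
    (layer_eq_zero c hk).1 (hL 0 (by omega)), (layer_eq_last c hk).1 (hL k le_rfl)⟩
  rw [hL i hi.le, hL (i + 1) hi]

/-- A climb of `k - 2` arcs fits into the layers `1, …, k - 1` only from the bottom to the top.
Hence its first and last arcs (the same arc if `k = 3`) are those that test the connections to `s`
and `t`. -/
theorem exists_isPath_inner_iff (hk : 3 ≤ k) {E : Fin n → Fin n → Prop} {w : Fin n × Fin n → Bool}
    {s t : Fin n} (hs : (s : ℕ) = 0) (ht : (t : ℕ) = 1)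
    (hE : ∀ u v, E u v ↔ 1 ≤ layer c u ∧ layer c v < k ∧ layer c v = layer c u + 1 ∧
      w (u, v) = true ∧ (layer c u = 1 → w (s, u) = true) ∧
      (layer c v + 1 = k → w (v, t) = true)) :
    (∃ v, IsPath E (k - 2) v) ↔ HasChain k (layer c) w := by
  constructor
  · rintro ⟨v, _, hp⟩
    have hstep := fun i hi => (hE _ _).1 (hp i hi)
    have hL : ∀ i ≤ k - 2, layer c (v i) = layer c (v 0) + i := by
      intro i hi
      induction i with
      | zero => rfl
      | succ i ih => rw [(hstep i (by omega)).2.2.1, ih (by omega)]; omega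
    have h0 := (hstep 0 (by omega)).1
    -- Here `j = k - 3` is the index of the last arc.
    obtain ⟨j, hj⟩ : ∃ j, k = j + 3 := ⟨k - 3, by omega⟩
    have hlast := hstep j (by omega)
    have hL0 : layer c (v 0) = 1 := by
      have h1 := hL (j + 1) (by omega)
      have h2 := hlast.2.1
      omega
    refine ⟨fun i => if i = 0 then s else if i = k then t else v (i - 1), fun i hi => ?_,
      fun i hi => ?_⟩
    · by_cases h1 : i = 0
      · simpa [h1] using (layer_eq_zero c (by omega)).2 hs
      by_cases h2 : i = k
      · simpa [h2, show k ≠ 0 by omega] using (layer_eq_last c (by omega)).2 ht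
      simp only [h1, h2, if_false]
      rw [hL _ (by omega)]
      omega
    · by_cases h1 : i = 0
      · subst h1
        simpa [show 1 ≠ k by omega] using (hstep 0 (by omega)).2.2.2.2.1 hL0
      by_cases h2 : i + 1 = k
      · have h3 := hlast.2.2.2.2.2 (by rw [hL _ (by omega)]; omega)
        simpa [h2, h1, show i ≠ k by omega, show i - 1 = j + 1 by omega, show k ≠ 0 by omega]
          using h3
      have h3 := (hstep (i - 1) (by omega)).2.2.2.1
      simpa [h1, h2, show i ≠ k by omega, show i - 1 + 1 = i by omega] using h3
  · rintro ⟨v, hL, hw⟩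
    have h0 : v 0 = s := Fin.ext (((layer_eq_zero c (by omega)).1 (hL 0 (by omega))).trans hs.symm)
    have h1 : v k = t := Fin.ext (((layer_eq_last c (by omega)).1 (hL k le_rfl)).trans ht.symm)
    refine ⟨fun i => v (i + 1), injOn_of_layer (L := layer c) (a := 1) fun i hi =>
      hL (i + 1) (by omega), fun i hi => (hE _ _).2 ?_⟩
    have h2 := hL (i + 1) (by omega)
    have h3 := hL (i + 1 + 1) (by omega)
    simp only [h2, h3]
    refine ⟨by omega, by omega, trivial, hw _ (by omega), fun h => ?_, fun h => ?_⟩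
    · have hi : i = 0 := by omega
      subst hi
      rw [← h0]
      exact hw 0 (by omega)
    · have hi : i + 1 + 1 + 1 = k := by omega
      have h4 := hw (i + 1 + 1) (by omega)
      rwa [hi, h1] at h4

end Layers

/-! ## Random colourings -/

/-- A random colouring gives prescribed distinct colours to `m` vertices with probability at least
`m⁻ᵐ`. -/
theorem card_colorings_le {V : Type} [Fintype V] [DecidableEq V] {m : ℕ} {f : Fin m → V}
    (hf : Function.Injective f) :
    Fintype.card (V → Fin m) ≤
      m ^ m * (Finset.univ.filter fun c : V → Fin m => ∀ j, c (f j) = j).card := by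
  classical
  let recolor : (V → Fin m) → V → Fin m := fun c u => if h : ∃ j, f j = u then h.choose else c u
  have hrec : ∀ c j, recolor c (f j) = j := fun c j => by
    have h : ∃ i, f i = f j := ⟨j, rfl⟩
    simp only [recolor, dif_pos h]
    exact hf h.choose_spec
  -- A colouring is recovered from its values on the `m` prescribed vertices, for which there are `m
  -- ^ m` options, together with the good colouring obtained by correcting these values.
  have hinj : Function.Injective fun c : V → Fin m => ((fun j => c (f j)),
      (⟨recolor c, by simp [hrec]⟩ :
        {d // d ∈ Finset.univ.filter fun c : V → Fin m => ∀ j, c (f j) = j})) := by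
    intro c d h
    simp only [Prod.mk.injEq, Subtype.mk.injEq] at h
    funext u
    by_cases hu : ∃ j, f j = u
    · obtain ⟨j, rfl⟩ := hu
      exact congrFun h.1 j
    · have := congrFun h.2 u
      simpa only [recolor, dif_neg hu] using this
  have := Fintype.card_le_of_injective _ hinj
  rw [Fintype.card_prod, Fintype.card_fun, Fintype.card_fin, Fintype.card_coe] at this
  simpa [Fintype.card_fun] using this

/-! ### Padding shorter paths to length `k`. -/

open Classical in
/-- The arcs of a directed graph, where the layers before the layer `p` are joined completely, and the
vertices of the layer `p` are replaced by the vertex `0`. -/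
noncomputable def paddedArcs {n : ℕ} (L : Fin n → ℕ) (p : ℕ) (s : Fin n)
    (x : ArcIndex (Fin n) → Bool) (a : Fin n × Fin n) : Bool :=
  decide (L a.1 < p ∨ (L a.1 = p ∧ (digraphOf x).Adj s a.2) ∨
    (p < L a.1 ∧ (digraphOf x).Adj a.1 a.2))

theorem exists_literal_adj {n : ℕ} (u v : Fin n) :
    ∃ h : ArcIndex (Fin n) ⊕ Bool, ∀ x, (digraphOf x).Adj u v ↔ litVal x h = true := by
  by_cases h : u = v
  · exact ⟨Sum.inr false, fun x => by simp [digraphOf, h, litVal]⟩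
  · exact ⟨Sum.inl ⟨(u, v), h⟩, fun x => by simp [digraphOf, h, litVal]⟩

theorem paddedArcs_eq_true {n : ℕ} {L : Fin n → ℕ} {p : ℕ} {s : Fin n}
    {x : ArcIndex (Fin n) → Bool} {u v : Fin n} : paddedArcs L p s x (u, v) = true ↔
      L u < p ∨ (L u = p ∧ (digraphOf x).Adj s v) ∨ (p < L u ∧ (digraphOf x).Adj u v) := by
  simp [paddedArcs]

theorem exists_literal_paddedArcs {n : ℕ} (L : Fin n → ℕ) (p : ℕ) (s : Fin n)
    (a : Fin n × Fin n) :
    ∃ h : ArcIndex (Fin n) ⊕ Bool, ∀ x, paddedArcs L p s x a = true ↔ litVal x h = true := by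
  rcases lt_trichotomy (L a.1) p with h | h | h
  · exact ⟨Sum.inr true, fun x => by simp [paddedArcs, h, litVal]⟩
  · obtain ⟨l, hl⟩ := exists_literal_adj s a.2
    exact ⟨l, fun x => by simp [paddedArcs, h, hl]⟩
  · obtain ⟨l, hl⟩ := exists_literal_adj a.1 a.2
    exact ⟨l, fun x => by simp [paddedArcs, h, hl, h.not_gt, h.ne']⟩

/-- Padding creates no false positives: discard the chain before layer `p` and put `s` in place of
its vertex there, whose outgoing arcs are those of `s`. Distinctness follows from the layers. -/
theorem mem_dirPathEqST_of_hasChain {k n p : ℕ} (hp : p < k) {s : Fin n} (hs : (s : ℕ) = 0)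
    {x : ArcIndex (Fin n) → Bool} (c : Fin n → Fin (k - 1))
    (h : HasChain k (layer c) (paddedArcs (layer c) p s x)) :
    x ∈ (dirPathEqST (k - p) n).yes := by
  obtain ⟨v, hL, hw⟩ := h
  rw [mem_dirPathEqST_yes]
  have hls : layer c s = 0 := (layer_eq_zero c (by omega)).2 hs
  refine ⟨fun i => if i = 0 then s else v (p + i), ⟨?_, fun i hi => ?_⟩, by simpa using hs, ?_⟩
  · intro i hi j hj hij
    simp only [Set.mem_Iic] at hi hj
    have h1 := congrArg (layer c) hij
    have h2 := hL (p + i) (by omega)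
    have h3 := hL (p + j) (by omega)
    simp only [] at h1
    split_ifs at h1 <;> omega
  · have h1 := hw (p + i) (by omega)
    rw [paddedArcs_eq_true, hL (p + i) (by omega)] at h1
    by_cases hi0 : i = 0
    · subst hi0
      simpa using h1
    · simpa [hi0, add_assoc, Nat.pos_of_ne_zero hi0] using h1
  · simp only [show k - p ≠ 0 by omega, if_false, show p + (k - p) = k by omega]
    exact (layer_eq_last c (by omega)).1 (hL k le_rfl)

/-- Insert `p` unused vertices after `s`; the last of them takes over the role of `s`. A colouring
that is right on the `k - 1` inner vertices of this longer sequence yields a chain. -/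
theorem card_hasChain_ge {k n p : ℕ} (hk : 2 ≤ k) (hp : p < k) (hn : k + 1 ≤ n) {s : Fin n}
    (hs : (s : ℕ) = 0) {x : ArcIndex (Fin n) → Bool} (h : x ∈ (dirPathEqST (k - p) n).yes) :
    ∃ G : Finset (Fin n → Fin (k - 1)),
      Fintype.card (Fin n → Fin (k - 1)) ≤ (k - 1) ^ (k - 1) * G.card ∧
      ∀ c ∈ G, HasChain k (layer c) (paddedArcs (layer c) p s x) := by
  classical
  rw [mem_dirPathEqST_yes] at h
  obtain ⟨u, ⟨hinj, hE⟩, h0, h1⟩ := h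
  let used : Finset (Fin n) := (Finset.range (k - p + 1)).image u
  -- The path occupies at most `k - p + 1` vertices, so `k + 1 ≤ n` leaves `p` free ones.
  have hcard : Fintype.card (Fin p) ≤ Fintype.card {a // a ∉ used} := by
    have h2 : used.card ≤ k - p + 1 := Finset.card_image_le.trans (by simp)
    rw [Fintype.card_subtype_compl, Fintype.card_coe, Fintype.card_fin, Fintype.card_fin]
    omega
  obtain ⟨e⟩ := Function.Embedding.nonempty_of_card_le hcard
  have hused : ∀ i ≤ k - p, u i ∈ used := fun i hi =>
    Finset.mem_image_of_mem u (Finset.mem_range.2 (by omega))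
  have hu0 : u 0 = s := Fin.ext (h0.trans hs.symm)
  -- Position `0` is `s`, positions `1, …, p` are fillers, and later ones follow `u` from `u 1` on.
  -- For `p = 0` this is `u` itself.
  let v : ℕ → Fin n := fun i =>
    if i = 0 then s else if hi : i - 1 < p then (e ⟨i - 1, hi⟩ : Fin n) else u (i - p)
  have hv0 : v 0 = s := rfl
  have hve : ∀ i (hi : i - 1 < p), i ≠ 0 → v i = e ⟨i - 1, hi⟩ := fun i hi h => by
    simp [v, h, hi]
  have hvu : ∀ i, p < i → v i = u (i - p) := fun i hi => by
    simp [v, show i ≠ 0 by omega, show ¬ (i - 1 < p) by omega]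
  have hvinj : Set.InjOn v (Set.Iic k) := by
    have key : ∀ i j, i < j → j ≤ k → v i ≠ v j := by
      intro i j hij hj
      by_cases hjp : j ≤ p
      · rw [hve j (by omega) (by omega)]
        by_cases hi : i = 0
        · subst hi
          intro heq
          refine (e ⟨j - 1, by omega⟩).2 ?_
          rw [← heq, hv0, ← hu0]
          exact hused 0 (by omega)
        · rw [hve i (by omega) hi]
          intro heq
          have := e.injective (Subtype.ext heq)
          simp only [Fin.mk.injEq] at this
          omega
      · rw [hvu j (by omega)]
        by_cases hi : i = 0
        · subst hi
          rw [hv0, ← hu0]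
          intro heq
          have := hinj (by simp) (by simp; omega) heq
          omega
        by_cases hip : i ≤ p
        · rw [hve i (by omega) hi]
          intro heq
          refine (e ⟨i - 1, by omega⟩).2 ?_
          rw [heq]
          exact hused _ (by omega)
        · rw [hvu i (by omega)]
          intro heq
          have := hinj (by simp; omega) (by simp; omega) heq
          omega
    intro i hi j hj hij
    rcases lt_trichotomy i j with h | h | h
    · exact absurd hij (key i j h hj)
    · exact h
    · exact absurd hij.symm (key j i h hi)
  have hvk : (v k : ℕ) = 1 := by rw [hvu k hp, h1]
  have hf : Function.Injective fun j : Fin (k - 1) => v (j + 1) := by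
    intro i j hij
    have := hvinj (show (i : ℕ) + 1 ≤ k by omega) (show (j : ℕ) + 1 ≤ k by omega) hij
    exact Fin.ext (by omega)
  refine ⟨_, card_colorings_le hf, fun c hc => ?_⟩
  have hc' := (Finset.mem_filter.1 hc).2
  have hL : ∀ i ≤ k, layer c (v i) = i := by
    intro i hi
    by_cases hi0 : i = 0
    · subst hi0
      exact (layer_eq_zero c (by omega)).2 hs
    by_cases hik : i = k
    · subst hik
      exact (layer_eq_last c (by omega)).2 hvk
    have h2 : (v i : ℕ) ≠ 0 := fun h2 => hi0 (hvinj hi (show 0 ≤ k by omega)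
      (Fin.ext (h2.trans hs.symm)))
    have h3 : (v i : ℕ) ≠ 1 := fun h2 => hik (hvinj hi (show k ≤ k from le_rfl)
      (Fin.ext (h2.trans hvk.symm)))
    have h4 := congrArg Fin.val (hc' ⟨i - 1, by omega⟩)
    simp only [show i - 1 + 1 = i by omega] at h4
    simp only [layer, h2, h3, if_false, h4]
    omega
  refine ⟨v, hL, fun i hi => ?_⟩
  rw [paddedArcs_eq_true, hL i hi.le]
  rcases lt_trichotomy i p with h | h | h
  · exact Or.inl h
  · refine Or.inr (Or.inl ⟨h, ?_⟩)
    have h2 := hE 0 (by omega)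
    rw [hvu (i + 1) (by omega), ← hu0, show i + 1 - p = 0 + 1 by omega]
    exact h2
  · refine Or.inr (Or.inr ⟨h, ?_⟩)
    have h2 := hE (i - p) (by omega)
    rw [hvu i h, hvu (i + 1) (by omega), show i + 1 - p = i - p + 1 by omega]
    exact h2

/-! ## Reductions between the path problems -/

theorem quantumQueryComplexity_le_of_restrict {ι : Type} [Fintype ι] [DecidableEq ι]
    {P P' : QueryProblem ι} (h : P.promise ⊆ P'.promise) (hy : P.yes = P'.yes) :
    quantumQueryComplexity P ≤ quantumQueryComplexity P' := by
  obtain ⟨A, hA⟩ := exists_solves_quantumQueryComplexity P'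
  exact Nat.sInf_le ⟨A, fun x hx => hy ▸ hA x (h hx)⟩

theorem litVal_bind {ι κ : Type} {x : ι → Bool} {w : κ → Bool} {g : κ → ι ⊕ Bool}
    (hg : ∀ j, w j = true ↔ litVal x (g j) = true) (l : κ ⊕ Bool) :
    litVal w l = true ↔ litVal x (l.elim g Sum.inr) = true := by
  cases l with
  | inl j => exact hg j
  | inr b => rfl

/-- Directed path problems with endpoints reduce to every problem that can detect chains in layered
graphs. The set `S` contains the differences of `k` and the allowed path lengths. -/
theorem exists_le_of_detects_chains {k : ℕ} (hk : 3 ≤ k) :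
    ∃ K : ℕ, ∀ {n : ℕ} (_ : k + 1 ≤ n) {S : Finset ℕ} (_ : S ⊆ Finset.range k) (_ : S.Nonempty)
      {P : QueryProblem (ArcIndex (Fin n))}
      (_ : ∀ x, x ∈ P.yes ↔ ∃ p ∈ S, x ∈ (dirPathEqST (k - p) n).yes)
      {κ : Type} [Fintype κ] [DecidableEq κ] (P' : QueryProblem κ)
      (y : (Fin n → Fin (k - 1)) → (Fin n × Fin n → Bool) → κ → Bool)
      (_ : ∀ c j, ∃ h : Fin 3 → (Fin n × Fin n) ⊕ Bool, ∀ w,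
        y c w j = true ↔ ∀ i, litVal w (h i) = true)
      (_ : ∀ c w, y c w ∈ P'.promise ∧ (y c w ∈ P'.yes ↔ HasChain k (layer c) w)),
      quantumQueryComplexity P ≤ K * quantumQueryComplexity P' := by
  have hk1 : (0 : ℝ) < ((k - 1 : ℕ) : ℝ) := by exact_mod_cast (by omega : 0 < k - 1)
  have hk0 : (0 : ℝ) < k := by exact_mod_cast (by omega : 0 < k)
  obtain ⟨K, hK⟩ := exists_quantumQueryComplexity_le
    -- The factor `k` bounds the number of guesses for `p`, the power is the cost of a random
    -- colouring. Neither depends on `n`, so `K` can be fixed first.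
    (δ := 1 / (k * ((k - 1 : ℕ) : ℝ) ^ (k - 1))) (by positivity) (m := 3) (by norm_num)
  refine ⟨K, fun {n} hn {S} hS hSne {P} hP {κ} _ _ P' y hy hyP => ?_⟩
  have : Nonempty S := hSne.to_subtype
  have : Nonempty (Fin (k - 1)) := ⟨⟨0, by omega⟩⟩
  let s : Fin n := ⟨0, by omega⟩
  refine hK (R := S × (Fin n → Fin (k - 1))) P P'
    (fun r x => y r.2 (paddedArcs (layer r.2) r.1 s x)) ?_ ?_ ?_
  · intro r j
    obtain ⟨h, hh⟩ := hy r.2 j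
    choose g hg using exists_literal_paddedArcs (layer r.2) r.1 s
    refine ⟨fun i => (h i).elim g Sum.inr, fun x => (hh _).trans (forall_congr' fun i => ?_)⟩
    exact litVal_bind (fun a => hg a x) (h i)
  · intro x _ hx
    obtain ⟨p, hpS, hp⟩ := (hP x).1 hx
    obtain ⟨G, hG, hG'⟩ := card_hasChain_ge (by omega) (Finset.mem_range.1 (hS hpS)) hn
      (s := s) rfl hp
    refine ⟨{(⟨p, hpS⟩ : S)} ×ˢ G, ?_, ?_⟩
    · rw [Finset.card_product, Finset.card_singleton, one_mul, Fintype.card_prod, Fintype.card_coe,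
        one_div, inv_mul_le_iff₀ (by positivity)]
      have h1 : S.card ≤ k := by simpa using Finset.card_le_card hS
      have h2 := Nat.mul_le_mul h1 hG
      rw [← mul_assoc] at h2
      exact_mod_cast h2
    · rintro ⟨p', c⟩ hc
      simp only [Finset.mem_product, Finset.mem_singleton] at hc
      obtain ⟨rfl, hc⟩ := hc
      exact ⟨(hyP c _).1, (hyP c _).2.2 (hG' c hc)⟩
  · rintro x _ hx ⟨⟨p, hpS⟩, c⟩
    exact ⟨(hyP c _).1, fun h => hx ((hP x).2 ⟨p, hpS, mem_dirPathEqST_of_hasChain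
      (Finset.mem_range.1 (hS hpS)) (s := s) rfl c ((hyP c _).2.1 h)⟩)⟩

/-! ### Layered instances of the target problems. -/

section Targets

variable {k n : ℕ}

/-- The directed graph with the arcs `(u, v)` from a layer to the next one for which `w` holds. -/
def layeredArcs (c : Fin n → Fin (k - 1)) (w : Fin n × Fin n → Bool) (a : ArcIndex (Fin n)) : Bool :=
  decide (layer c a.1.2 = layer c a.1.1 + 1) && w a.1

theorem layeredArcs_adj {c : Fin n → Fin (k - 1)} {w : Fin n × Fin n → Bool} (u v : Fin n) :
    (digraphOf (layeredArcs c w)).Adj u v ↔ layer c v = layer c u + 1 ∧ w (u, v) = true := by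
  simp only [digraphOf, layeredArcs, Bool.and_eq_true, decide_eq_true_iff, exists_prop]
  refine and_iff_right_of_imp ?_
  rintro ⟨h, _⟩ rfl
  omega

theorem exists_literals_layeredArcs (c : Fin n → Fin (k - 1)) (a : ArcIndex (Fin n)) :
    ∃ h : Fin 3 → (Fin n × Fin n) ⊕ Bool, ∀ w,
      layeredArcs c w a = true ↔ ∀ i, litVal w (h i) = true :=
  ⟨![Sum.inr (decide (layer c a.1.2 = layer c a.1.1 + 1)), Sum.inl a.1, Sum.inr true], fun w => by
    simp [Fin.forall_fin_succ, litVal, layeredArcs]⟩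

theorem layeredArcs_mem_dirPathEqST_iff (hk : 0 < k) (c : Fin n → Fin (k - 1))
    (w : Fin n × Fin n → Bool) (l : ℕ) :
    layeredArcs c w ∈ (dirPathEqST l n).yes ↔ l = k ∧ HasChain k (layer c) w := by
  rw [mem_dirPathEqST_yes]
  constructor
  · rintro ⟨v, hv⟩
    exact layered_path c hk layeredArcs_adj hv
  · rintro ⟨rfl, h⟩
    exact h.exists_isPathST c hk fun u v h1 h2 => (layeredArcs_adj u v).2 ⟨h1, h2⟩

theorem layeredArcs_mem_dirPathLeST_iff (hk : 0 < k) (c : Fin n → Fin (k - 1))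
    (w : Fin n × Fin n → Bool) :
    layeredArcs c w ∈ (dirPathLeST k n).yes ↔ HasChain k (layer c) w := by
  constructor
  · rintro ⟨l, _, _, h⟩
    exact ((layeredArcs_mem_dirPathEqST_iff hk c w l).1 h).2
  · exact fun h => ⟨k, hk, le_rfl, (layeredArcs_mem_dirPathEqST_iff hk c w k).2 ⟨rfl, h⟩⟩

/-- Any `s`-`t` path in a layered graph, of whatever length, already comes from a chain. -/
theorem layeredArcs_mem_promise (hk : 0 < k) (c : Fin n → Fin (k - 1))
    (w : Fin n × Fin n → Bool) {P : QueryProblem (ArcIndex (Fin n))} (hP : P.promise = Set.univ)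
    (h : layeredArcs c w ∈ P.yes ↔ HasChain k (layer c) w) :
    layeredArcs c w ∈ (promDirST P).promise := by
  refine ⟨by simp [hP], ?_⟩
  rintro ⟨l, _, hl⟩
  exact h.2 ((layeredArcs_mem_dirPathEqST_iff hk c w l).1 hl).2

open Classical in
/-- The undirected version of `layeredArcs`. -/
noncomputable def layeredEdges (c : Fin n → Fin (k - 1)) (w : Fin n × Fin n → Bool)
    (e : EdgeIndex (Fin n)) : Bool :=
  decide (∃ u v, e.1 = s(u, v) ∧ layer c v = layer c u + 1 ∧ w (u, v) = true)

theorem layeredEdges_adj {c : Fin n → Fin (k - 1)} {w : Fin n × Fin n → Bool} (u v : Fin n) :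
    (graphOf (layeredEdges c w)).Adj u v ↔ (layer c v = layer c u + 1 ∧ w (u, v) = true) ∨
      (layer c u = layer c v + 1 ∧ w (v, u) = true) := by
  simp only [graphOf, layeredEdges, decide_eq_true_iff, exists_prop, Sym2.mk_isDiag_iff]
  constructor
  · rintro ⟨_, a, b, h, h'⟩
    rcases Sym2.eq_iff.1 h with ⟨rfl, rfl⟩ | ⟨rfl, rfl⟩
    · exact Or.inl h'
    · exact Or.inr h'
  · rintro (h | h)
    · exact ⟨fun e => by subst e; omega, u, v, rfl, h⟩
    · exact ⟨fun e => by subst e; omega, v, u, Sym2.eq_swap, h⟩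

/-- At most one orientation of an edge climbs a layer, so no disjunction of two literals arises. -/
theorem exists_literals_layeredEdges (c : Fin n → Fin (k - 1)) (e : EdgeIndex (Fin n)) :
    ∃ h : Fin 3 → (Fin n × Fin n) ⊕ Bool, ∀ w,
      layeredEdges c w e = true ↔ ∀ i, litVal w (h i) = true := by
  by_cases he : ∃ u v, e.1 = s(u, v) ∧ layer c v = layer c u + 1
  · obtain ⟨u, v, he, huv⟩ := he
    refine ⟨fun _ => Sum.inl (u, v), fun w => ?_⟩
    simp only [layeredEdges, decide_eq_true_iff, litVal, Sum.elim_inl, forall_const]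
    constructor
    · rintro ⟨a, b, h, hL, h'⟩
      rcases Sym2.eq_iff.1 (he.symm.trans h) with ⟨rfl, rfl⟩ | ⟨rfl, rfl⟩
      · exact h'
      · omega
    · exact fun h => ⟨u, v, he, huv, h⟩
  · refine ⟨fun _ => Sum.inr false, fun w => ?_⟩
    simp only [layeredEdges, decide_eq_true_iff, litVal, Sum.elim_inr, forall_const]
    constructor
    · rintro ⟨a, b, h, hL, _⟩
      exact absurd ⟨a, b, h, hL⟩ he
    · intro h
      simp at h

theorem layeredEdges_mem_pathEqST_iff (hk : 0 < k) (c : Fin n → Fin (k - 1))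
    (w : Fin n × Fin n → Bool) {l : ℕ} (hl : l ≤ k) :
    layeredEdges c w ∈ (pathEqST l n).yes ↔ l = k ∧ HasChain k (layer c) w := by
  rw [mem_pathEqST_yes]
  constructor
  · rintro ⟨v, hv⟩
    exact layered_path_symm c hk layeredEdges_adj hl hv
  · rintro ⟨rfl, h⟩
    exact h.exists_isPathST c hk fun u v h1 h2 => (layeredEdges_adj u v).2 (Or.inl ⟨h1, h2⟩)

theorem layeredEdges_mem_pathLeST_iff (hk : 0 < k) (c : Fin n → Fin (k - 1))
    (w : Fin n × Fin n → Bool) :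
    layeredEdges c w ∈ (pathLeST k n).yes ↔ HasChain k (layer c) w := by
  constructor
  · rintro ⟨l, _, hl, h⟩
    exact ((layeredEdges_mem_pathEqST_iff hk c w hl).1 h).2
  · exact fun h => ⟨k, hk, le_rfl, (layeredEdges_mem_pathEqST_iff hk c w le_rfl).2 ⟨rfl, h⟩⟩

/-- The arcs between the inner layers, where the vertices of the first and the last inner layer have
to be joined to `s` and `t`, respectively. -/
def innerArcs (s t : Fin n) (c : Fin n → Fin (k - 1)) (w : Fin n × Fin n → Bool)
    (a : ArcIndex (Fin n)) : Bool :=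
  decide (1 ≤ layer c a.1.1 ∧ layer c a.1.2 < k ∧ layer c a.1.2 = layer c a.1.1 + 1 ∧
    w a.1 = true ∧ (layer c a.1.1 = 1 → w (s, a.1.1) = true) ∧
    (layer c a.1.2 + 1 = k → w (a.1.2, t) = true))

theorem innerArcs_adj {s t : Fin n} {c : Fin n → Fin (k - 1)} {w : Fin n × Fin n → Bool}
    (u v : Fin n) :
    (digraphOf (innerArcs s t c w)).Adj u v ↔ 1 ≤ layer c u ∧ layer c v < k ∧
      layer c v = layer c u + 1 ∧ w (u, v) = true ∧ (layer c u = 1 → w (s, u) = true) ∧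
      (layer c v + 1 = k → w (v, t) = true) := by
  simp only [digraphOf, innerArcs, decide_eq_true_iff, exists_prop]
  refine and_iff_right_of_imp ?_
  rintro ⟨_, _, h, _⟩ rfl
  omega

/-- The three literals are the arc itself, the arc from `s` and the arc to `t`; all three matter
when `k = 3`. This is what sets the number of literals in `exists_le_of_detects_chains`. -/
theorem exists_literals_innerArcs (s t : Fin n) (c : Fin n → Fin (k - 1)) (a : ArcIndex (Fin n)) :
    ∃ h : Fin 3 → (Fin n × Fin n) ⊕ Bool, ∀ w,
      innerArcs s t c w a = true ↔ ∀ i, litVal w (h i) = true := by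
  by_cases ha : 1 ≤ layer c a.1.1 ∧ layer c a.1.2 < k ∧ layer c a.1.2 = layer c a.1.1 + 1
  · refine ⟨![Sum.inl a.1, if layer c a.1.1 = 1 then Sum.inl (s, a.1.1) else Sum.inr true,
      if layer c a.1.2 + 1 = k then Sum.inl (a.1.2, t) else Sum.inr true], fun w => ?_⟩
    simp only [innerArcs, decide_eq_true_iff, Fin.forall_fin_succ, IsEmpty.forall_iff, and_true,
      Matrix.cons_val_zero, Matrix.cons_val_succ]
    rw [← and_assoc, ← and_assoc, and_assoc (a := 1 ≤ _), and_iff_right ha]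
    refine and_congr Iff.rfl (and_congr ?_ ?_) <;> split_ifs with h <;> simp [litVal, h]
  · refine ⟨fun _ => Sum.inr false, fun w => ?_⟩
    simp only [innerArcs, decide_eq_true_iff, litVal, Sum.elim_inr, forall_const]
    exact ⟨fun h => absurd ⟨h.1, h.2.1, h.2.2.1⟩ ha, fun h => by simp at h⟩

end Targets

/-- The arcs in both directions for all edges of an undirected graph. -/
noncomputable def symmetricArcs {n : ℕ} (x : EdgeIndex (Fin n) → Bool) (a : ArcIndex (Fin n)) :
    Bool :=
  x ⟨s(a.1.1, a.1.2), by simpa using a.2⟩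

theorem symmetricArcs_mem_dirPathEqST_iff {n l : ℕ} (x : EdgeIndex (Fin n) → Bool) :
    symmetricArcs x ∈ (dirPathEqST l n).yes ↔ x ∈ (pathEqST l n).yes := by
  have h : (digraphOf (symmetricArcs x)).Adj = (graphOf x).Adj := by
    funext u v
    simp [digraphOf, graphOf, symmetricArcs]
  rw [mem_dirPathEqST_yes, mem_pathEqST_yes, h]

theorem exists_le_of_symmetricArcs : ∃ K : ℕ, ∀ {n : ℕ} (P : QueryProblem (EdgeIndex (Fin n)))
    (P' : QueryProblem (ArcIndex (Fin n))), P'.promise = Set.univ →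
    (∀ x, symmetricArcs x ∈ P'.yes ↔ x ∈ P.yes) →
    quantumQueryComplexity P ≤ K * quantumQueryComplexity P' := by
  obtain ⟨K, hK⟩ := exists_quantumQueryComplexity_le one_pos one_pos
  refine ⟨K, fun P P' hP' h => hK (R := Unit) P P' (fun _ => symmetricArcs)
    (fun _ a => ⟨fun _ => Sum.inl ⟨s(a.1.1, a.1.2), by simpa using a.2⟩, fun x => ?_⟩)
    (fun x _ hx => ⟨Finset.univ, by simp, fun _ _ => ⟨by simp [hP'], (h x).2 hx⟩⟩)
    (fun x _ hx _ => ⟨by simp [hP'], fun hy => hx ((h x).1 hy)⟩)⟩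
  simp [litVal, symmetricArcs]

/-! ### From free paths to paths between `s` and `t`. -/

/-- Rename the vertices, and join `0` to all vertices and all vertices to `1`. -/
def attachEnds {n : ℕ} (π : Equiv.Perm (Fin n)) (x : ArcIndex (Fin n) → Bool)
    (a : ArcIndex (Fin n)) : Bool :=
  decide ((a.1.1 : ℕ) = 0 ∨ (a.1.2 : ℕ) = 1) ||
    x ⟨(π a.1.1, π a.1.2), fun h => a.2 (π.injective h)⟩

theorem attachEnds_adj {n : ℕ} {π : Equiv.Perm (Fin n)} {x : ArcIndex (Fin n) → Bool}
    {u v : Fin n} : (digraphOf (attachEnds π x)).Adj u v ↔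
      u ≠ v ∧ ((u : ℕ) = 0 ∨ (v : ℕ) = 1 ∨ (digraphOf x).Adj (π u) (π v)) := by
  by_cases h : u = v
  · simp [digraphOf, h]
  · simp [digraphOf, attachEnds, h, or_assoc]

/-- Drop both end vertices. The remaining ones differ from `0` and `1`, so none of the arcs between
them is an added one. -/
theorem mem_dirPathEq_of_attachEnds {n k : ℕ} (hk : 2 ≤ k) {π : Equiv.Perm (Fin n)}
    {x : ArcIndex (Fin n) → Bool} (h : attachEnds π x ∈ (dirPathEqST k n).yes) :
    x ∈ (dirPathEq (k - 2) n).yes := by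
  rw [mem_dirPathEqST_yes] at h
  rw [mem_dirPathEq_yes]
  obtain ⟨v, ⟨hinj, hE⟩, h0, h1⟩ := h
  refine ⟨fun i => π (v (i + 1)), fun i hi j hj hij => ?_, fun i hi => ?_⟩
  · simp only [Set.mem_Iic] at hi hj
    have := hinj (show i + 1 ≤ k by omega) (show j + 1 ≤ k by omega) (π.injective hij)
    omega
  · rcases (attachEnds_adj.1 (hE (i + 1) (by omega))).2 with h | h | h
    · have := hinj (show i + 1 ≤ k by omega) (show 0 ≤ k by omega) (Fin.ext (h.trans h0.symm))
      omega
    · have := hinj (show i + 1 + 1 ≤ k by omega) (show k ≤ k from le_rfl)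
        (Fin.ext (h.trans h1.symm))
      omega
    · exact h

theorem attachEnds_mem_dirPathEqST {n k : ℕ} (hk : 2 ≤ k) {π : Equiv.Perm (Fin n)} {s t : Fin n}
    (hs : (s : ℕ) = 0) (ht : (t : ℕ) = 1) {x : ArcIndex (Fin n) → Bool} {v : ℕ → Fin n}
    (hv : IsPath (digraphOf x).Adj (k - 2) v) (hvs : ∀ i ≤ k - 2, v i ≠ π s)
    (hvt : ∀ i ≤ k - 2, v i ≠ π t) : attachEnds π x ∈ (dirPathEqST k n).yes := by
  rw [mem_dirPathEqST_yes]
  obtain ⟨hinj, hE⟩ := hv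
  have hst : s ≠ t := fun h => by rw [h, ht] at hs; omega
  have hs' : ∀ i ≤ k - 2, π.symm (v i) ≠ s := fun i hi h => hvs i hi (by rw [← h]; simp)
  have ht' : ∀ i ≤ k - 2, π.symm (v i) ≠ t := fun i hi h => hvt i hi (by rw [← h]; simp)
  let u : ℕ → Fin n := fun i => if i = 0 then s else if i = k then t else π.symm (v (i - 1))
  have hu0 : u 0 = s := rfl
  have huk : u k = t := by simp [u, show k ≠ 0 by omega]
  have hu : ∀ i, i ≠ 0 → i ≠ k → u i = π.symm (v (i - 1)) := fun i h h' => by simp [u, h, h']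
  have hne : ∀ i j, i < j → j ≤ k → u i ≠ u j := by
    intro i j hij hj
    by_cases hi : i = 0
    · subst hi
      by_cases hjk : j = k
      · rwa [hjk, hu0, huk]
      · rw [hu0, hu j (by omega) hjk]
        exact (hs' _ (by omega)).symm
    · rw [hu i hi (by omega)]
      by_cases hjk : j = k
      · rw [hjk, huk]
        exact ht' _ (by omega)
      · rw [hu j (by omega) hjk]
        intro h
        have := hinj (show i - 1 ≤ k - 2 by omega) (show j - 1 ≤ k - 2 by omega)
          (π.symm.injective h)
        omega
  refine ⟨u, ⟨fun i hi j hj hij => ?_, fun i hi => attachEnds_adj.2 ⟨hne _ _ (by omega) hi, ?_⟩⟩,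
    hs, by rw [huk, ht]⟩
  · rcases lt_trichotomy i j with h | h | h
    · exact absurd hij (hne i j h hj)
    · exact h
    · exact absurd hij.symm (hne j i h hi)
  · by_cases hi0 : i = 0
    · subst hi0
      exact Or.inl hs
    by_cases hik : i + 1 = k
    · rw [hik, huk]
      exact Or.inr (Or.inl ht)
    have h1 := hE (i - 1) (by omega)
    rw [hu i hi0 (by omega), hu (i + 1) (by omega) hik]
    simpa [show i - 1 + 1 = i by omega] using Or.inr (Or.inr h1)

/-- The free path may run through `s` or `t`. A random one of the `k` disjoint pairs `{2j, 2j+1}` is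
therefore renamed to `{s, t}`; the path has only `k - 1` vertices and misses one of the pairs, which
gives success probability at least `1/k`. -/
theorem exists_dirPathEq_le {k : ℕ} (hk : 2 ≤ k) : ∃ K : ℕ, ∀ {n : ℕ}, 2 * k ≤ n →
    quantumQueryComplexity (dirPathEq (k - 2) n) ≤
      K * quantumQueryComplexity (dirPathEqST k n) := by
  have hk0 : (0 : ℝ) < k := by exact_mod_cast (by omega : 0 < k)
  obtain ⟨K, hK⟩ := exists_quantumQueryComplexity_le (δ := 1 / (k : ℝ)) (by positivity) one_pos
  refine ⟨K, fun {n} hn => ?_⟩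
  let s : Fin n := ⟨0, by omega⟩
  let t : Fin n := ⟨1, by omega⟩
  let a : Fin k → Fin n := fun j => ⟨2 * j, by omega⟩
  let b : Fin k → Fin n := fun j => ⟨2 * j + 1, by omega⟩
  let π : Fin k → Equiv.Perm (Fin n) := fun j => Equiv.swap s (a j) * Equiv.swap t (b j)
  have hπs : ∀ j, π j s = a j := fun j => by
    have h1 : Equiv.swap t (b j) s = s :=
      Equiv.swap_apply_of_ne_of_ne (by simp [s, t]) (by simp [s, b, Fin.ext_iff])
    simp [π, h1]
  have hπt : ∀ j, π j t = b j := fun j => by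
    have h1 : Equiv.swap s (a j) (b j) = b j :=
      Equiv.swap_apply_of_ne_of_ne (by simp [s, b]) (by simp [a, b])
    simp [π, h1]
  have : Nonempty (Fin k) := ⟨⟨0, by omega⟩⟩
  refine hK (dirPathEq (k - 2) n) (dirPathEqST k n) (fun j => attachEnds (π j)) ?_ ?_ ?_
  · intro j e
    by_cases h : (e.1.1 : ℕ) = 0 ∨ (e.1.2 : ℕ) = 1
    · exact ⟨fun _ => Sum.inr true, fun x => by simp [attachEnds, h, litVal]⟩
    · exact ⟨fun _ => Sum.inl ⟨(π j e.1.1, π j e.1.2), fun h => e.2 ((π j).injective h)⟩,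
        fun x => by simp [attachEnds, h, litVal]⟩
  · intro x _ hx
    obtain ⟨v, hv⟩ := mem_dirPathEq_yes.1 hx
    -- Halving maps a vertex to the number of its pair, so this is the pigeonhole principle.
    obtain ⟨j, hj⟩ : ∃ j : Fin k, ∀ i ≤ k - 2, ((v i : Fin n) : ℕ) / 2 ≠ j := by
      by_contra! hcon
      have h1 : Finset.range k ⊆ (Finset.range (k - 1)).image fun i => (v i : ℕ) / 2 := by
        intro j hj
        obtain ⟨i, hi, h⟩ := hcon ⟨j, Finset.mem_range.1 hj⟩
        exact Finset.mem_image.2 ⟨i, Finset.mem_range.2 (by omega), h⟩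
      have h2 := (Finset.card_le_card h1).trans Finset.card_image_le
      simp only [Finset.card_range] at h2
      omega
    refine ⟨{j}, by simp [hk0.ne'], fun r hr => ?_⟩
    rw [Finset.mem_singleton.1 hr]
    refine ⟨Set.mem_univ _, attachEnds_mem_dirPathEqST hk (s := s) (t := t) rfl rfl hv ?_ ?_⟩
    · intro i hi h
      refine hj i hi ?_
      rw [h, hπs]
      simp [a]
    · intro i hi h
      refine hj i hi ?_
      rw [h, hπt]
      simp only [b]
      omega
  · exact fun x _ hx j => ⟨Set.mem_univ _, fun h => hx (mem_dirPathEq_of_attachEnds hk h)⟩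

/-! ## The equivalence of the path problems -/

/-- `f` is eventually at most a constant multiple of `g`. -/
def EventuallyLe (f g : ℕ → ℕ) : Prop := ∃ K, ∀ᶠ n in atTop, f n ≤ K * g n

theorem EventuallyLe.trans {f g h : ℕ → ℕ} (hfg : EventuallyLe f g) (hgh : EventuallyLe g h) :
    EventuallyLe f h := by
  obtain ⟨K, hK⟩ := hfg
  obtain ⟨M, hM⟩ := hgh
  refine ⟨K * M, ?_⟩
  filter_upwards [hK, hM] with n h1 h2
  calc f n ≤ K * g n := h1
    _ ≤ K * (M * h n) := Nat.mul_le_mul_left K h2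
    _ = K * M * h n := (mul_assoc _ _ _).symm

theorem EventuallyLe.isBigO {f g : ℕ → ℕ} (h : EventuallyLe f g) :
    (fun n : ℕ => (f n : ℝ)) =O[atTop] (fun n : ℕ => (g n : ℝ)) := by
  obtain ⟨K, hK⟩ := h
  refine IsBigO.of_bound K ?_
  filter_upwards [hK] with n hn
  simp only [Real.norm_natCast]
  exact_mod_cast hn

/-- One hub suffices, by transitivity. Exact length uses the single guess `p = 0`; length at most
`k` uses all `p < k`, with `p = k - l`. -/
theorem pathComplexities_equiv {k : ℕ} (hk : 3 ≤ k) {f : ℕ → ℕ} (hf : f ∈ pathComplexities k) :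
    EventuallyLe f (fun n => quantumQueryComplexity (dirPathEqST k n)) ∧
      EventuallyLe (fun n => quantumQueryComplexity (dirPathEqST k n)) f := by
  have hk0 : 0 < k := by omega
  obtain ⟨K, hK⟩ := exists_le_of_detects_chains hk
  obtain ⟨K', hK'⟩ := exists_le_of_symmetricArcs
  have hge : ∀ᶠ n in atTop, k + 1 ≤ n := eventually_ge_atTop (k + 1)
  have h0 : ({0} : Finset ℕ) ⊆ Finset.range k := by simpa using hk0
  have hA : ∀ {n} (x : ArcIndex (Fin n) → Bool), x ∈ (dirPathEqST k n).yes ↔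
      ∃ p ∈ ({0} : Finset ℕ), x ∈ (dirPathEqST (k - p) n).yes := by simp
  have hB : ∀ {n} (x : ArcIndex (Fin n) → Bool), x ∈ (dirPathLeST k n).yes ↔
      ∃ p ∈ Finset.range k, x ∈ (dirPathEqST (k - p) n).yes := by
    intro n x
    constructor
    · rintro ⟨l, hl, hlk, h⟩
      exact ⟨k - l, Finset.mem_range.2 (by omega), by rwa [show k - (k - l) = l by omega]⟩
    · rintro ⟨p, hp, h⟩
      have := Finset.mem_range.1 hp
      exact ⟨k - p, by omega, by omega, h⟩
  have hEq : ∀ {n} (c : Fin n → Fin (k - 1)) (w : Fin n × Fin n → Bool),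
      layeredArcs c w ∈ (dirPathEqST k n).yes ↔ HasChain k (layer c) w := fun c w => by
    simpa using layeredArcs_mem_dirPathEqST_iff hk0 c w k
  -- The upper bounds for all three problems with length at most `k` pass through this inequality.
  have hle : EventuallyLe (fun n => quantumQueryComplexity (dirPathLeST k n))
      (fun n => quantumQueryComplexity (dirPathEqST k n)) := by
    refine ⟨K, ?_⟩
    filter_upwards [hge] with n hn
    exact hK hn subset_rfl ⟨0, by simpa using hk0⟩ hB _ layeredArcs exists_literals_layeredArcs
      fun c w => ⟨Set.mem_univ _, hEq c w⟩
  rcases hf with rfl | rfl | rfl | rfl | rfl | rfl | rfl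
  · exact ⟨⟨1, by simp⟩, ⟨1, by simp⟩⟩
  · refine ⟨hle, K, ?_⟩
    filter_upwards [hge] with n hn
    exact hK hn h0 (by simp) hA _ layeredArcs exists_literals_layeredArcs
      fun c w => ⟨Set.mem_univ _, layeredArcs_mem_dirPathLeST_iff hk0 c w⟩
  · refine ⟨⟨1, Eventually.of_forall fun n => ?_⟩, K, ?_⟩
    · rw [one_mul]
      exact quantumQueryComplexity_le_of_restrict (fun x hx => hx.1) rfl
    · filter_upwards [hge] with n hn
      exact hK hn h0 (by simp) hA _ layeredArcs exists_literals_layeredArcs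
        fun c w => ⟨layeredArcs_mem_promise hk0 c w rfl (hEq c w), hEq c w⟩
  · refine ⟨EventuallyLe.trans ⟨1, Eventually.of_forall fun n => ?_⟩ hle, K, ?_⟩
    · rw [one_mul]
      exact quantumQueryComplexity_le_of_restrict (fun x hx => hx.1) rfl
    · filter_upwards [hge] with n hn
      exact hK hn h0 (by simp) hA _ layeredArcs exists_literals_layeredArcs
        fun c w => ⟨layeredArcs_mem_promise hk0 c w rfl (layeredArcs_mem_dirPathLeST_iff hk0 c w),
          layeredArcs_mem_dirPathLeST_iff hk0 c w⟩
  · refine ⟨⟨K', Eventually.of_forall fun n => hK' _ _ rfl symmetricArcs_mem_dirPathEqST_iff⟩,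
      K, ?_⟩
    filter_upwards [hge] with n hn
    exact hK hn h0 (by simp) hA _ layeredEdges exists_literals_layeredEdges
      fun c w => ⟨Set.mem_univ _, by simpa using layeredEdges_mem_pathEqST_iff hk0 c w le_rfl⟩
  · refine ⟨EventuallyLe.trans ⟨K', Eventually.of_forall fun n => hK' _ _ rfl fun x => ?_⟩ hle,
      K, ?_⟩
    · exact exists_congr fun l => and_congr_right fun _ => and_congr_right fun _ =>
        symmetricArcs_mem_dirPathEqST_iff x
    filter_upwards [hge] with n hn
    exact hK hn h0 (by simp) hA _ layeredEdges exists_literals_layeredEdges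
      fun c w => ⟨Set.mem_univ _, layeredEdges_mem_pathLeST_iff hk0 c w⟩
  · obtain ⟨M, hM⟩ := exists_dirPathEq_le (k := k) (by omega)
    refine ⟨⟨M, ?_⟩, K, ?_⟩
    · filter_upwards [eventually_ge_atTop (2 * k)] with n hn
      exact hM hn
    · filter_upwards [hge] with n hn
      refine hK hn h0 (by simp) hA _ (innerArcs ⟨0, by omega⟩ ⟨1, by omega⟩)
        (exists_literals_innerArcs _ _) fun c w => ⟨Set.mem_univ _, ?_⟩
      rw [mem_dirPathEq_yes]
      exact exists_isPath_inner_iff c hk rfl rfl innerArcs_adj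

theorem mainTheorem7 (k : ℕ) (hk : 3 ≤ k) :
    ∀ f ∈ pathComplexities k, ∀ g ∈ pathComplexities k,
      (fun n : ℕ => (f n : ℝ)) =Θ[atTop] (fun n : ℕ => (g n : ℝ)) := by
  intro f hf g hg
  have h1 := pathComplexities_equiv hk hf
  have h2 := pathComplexities_equiv hk hg
  exact ⟨(h1.1.trans h2.2).isBigO, (h2.1.trans h1.2).isBigO⟩
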